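/- Let $S$ be a measurable space and let $\nu$ be a $\sigma$-finite complex measure on $S$, i.e. $\nu(dx)=\theta(x)\,|\nu|(dx)$ with $|\nu|$ a $\sigma$-finite positive measure (possibly of infinite mass) and $\theta:S\to\mathbb C$ measurable with $|\theta|=1$. Let $w:S\times S\to\{u\in\mathbb C:|u|\le 1\}$ be measurable and symmetric. For $n\ge 1$ put $$\omega_n(x_1,\dots,x_n)=\prod_{1\le i<j\le n}w(x_i,x_j),\qquad \omega^T_n(x_1,\dots,x_n)=\sum_{G}\ \prod_{\{i,j\}\in E(G)}[w(x_i,x_j)-1],$$ where $G$ runs over the connected graphs with vertex set $\{1,\dots,n\}$ (so $\omega^T_1=1$). For measurable $\Lambda\subset S$ with $|\nu|(\Lambda)<\infty$ and $z\in\mathbb C$ let $$\Xi_\Lambda(z\nu)=1+\sum_{n\ge1}\frac{z^n}{n!}\int_{\Lambda^n}\omega_n(x_1,\dots,x_n)\,\nu(dx_1)\cdots\nu(dx_n),$$ and let $\ln\Xi_\Lambda(\nu)$ denote the value at $z=1$ of the continuous branch of $z\mapsto\ln\Xi_\Lambda(z\nu)$ on the closed unit disc that vanishes at $z=0$, if such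 a branch exists (it is then unique). Define the pinned and the absolute pinned cluster expansions $$\Gamma(\nu)(x)=\sum_{n\ge0}\frac1{n!}\int_{S^n}\omega^T_{n+1}(x,x_1,\dots,x_n)\,\nu(dx_1)\cdots\nu(dx_n),$$ $$|\Gamma|(\nu)(x)=\sum_{n\ge0}\frac1{n!}\int_{S^n}|\omega^T_{n+1}(x,x_1,\dots,x_n)|\,|\nu|(dx_1)\cdots|\nu|(dx_n)\in[0,\infty],$$ and, for $\mu:S\to[0,\infty]$, $$\Psi(\mu)(x)=1+\sum_{n\ge1}\frac1{n!}\int_{S^n}\prod_{i=1}^n|w(x,x_i)-1|\prod_{1\le i<j\le n}|w(x_i,x_j)|\ \prod_{i=1}^n\mu(x_i)\,|\nu|(dx_i).$$ Suppose that $\Psi(\mu)(x)\le\mu(x)$ for all $x\in S$. Then: (i) For every $x\in S$, $|\Gamma(\nu)(x)|\le|\Gamma|(\nu)(x)\le\mu(x)$. In particular, at every $x$ with $\mu(x)<\infty$ all the integrals in $\Gamma(\nu)(x)$ and the series itself converge absolutely. (At the points where $\mu(x)=\infty$ the first inequality is read with the convention that a divergent integral or series has the value $0$.) (ii) For every measurable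 $\Lambda\subset S$ with $|\nu|(\Lambda)<\infty$, $$\sum_{n\ge1}\frac1{n!}\int_{\Lambda^n}|\omega^T_n(x_1,\dots,x_n)|\,|\nu|(dx_1)\cdots|\nu|(dx_n)\ \le\ \int_\Lambda\mu\,d|\nu|.$$ If moreover $\mu<\infty$ $|\nu|$-almost everywhere on $\Lambda$, then the left-hand side is finite, $\ln\Xi_\Lambda(\nu)$ exists, the cluster expansion $$\ln\Xi_\Lambda(\nu)=\sum_{n\ge1}\frac1{n!}\int_{\Lambda^n}\omega^T_n(x_1,\dots,x_n)\,\nu(dx_1)\cdots\nu(dx_n)$$ holds with absolutely convergent integrals and series, and $$|\ln\Xi_\Lambda(\nu)|\ \le\ \sum_{n\ge1}\frac1{n!}\int_{\Lambda^n}|\omega^T_n(x_1,\dots,x_n)|\,|\nu|(dx_1)\cdots|\nu|(dx_n)\ \le\ \int_\Lambda\mu\,d|\nu|.$$ -/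

import Mathlib

open MeasureTheory
open scoped ENNReal Nat

noncomputable section

namespace PinnedCluster

/-- A σ-finite complex measure `ν` on `S`, given by its polar decomposition
`ν(dx) = phase(x) |ν|(dx)`: the total variation `|ν|` is a σ-finite positive measure, possibly of
infinite mass, and the phase is a measurable unimodular function. Thus `ν(A) = ∫_A phase d|ν|`
whenever `|ν|(A) < ∞`. A positive measure has phase `1`; a measure `ξ(x) dx` with complex density
`ξ` has total variation `|ξ(x)| dx` and phase `ξ/|ξ|`. -/
structure SigmaFiniteComplexMeasure (S : Type*) [MeasurableSpace S] where
  /-- the total variation measure `|ν|` -/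
  variation : Measure S
  sigmaFinite : SigmaFinite variation
  /-- the Radon-Nikodym density of `ν` with respect to `|ν|` -/
  phase : S → ℂ
  measurable_phase : Measurable phase
  norm_phase : ∀ x, ‖phase x‖ = 1

attribute [instance] SigmaFiniteComplexMeasure.sigmaFinite

variable {S : Type*} [MeasurableSpace S]

/-- The positive product measure `|ν|(dx₁) ⋯ |ν|(dxₙ)` on `Sⁿ`. -/
def SigmaFiniteComplexMeasure.variationPow (ν : SigmaFiniteComplexMeasure S) (n : ℕ) :
    Measure (Fin n → S) :=
  Measure.pi fun _ => ν.variation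

/-- The phase of the complex product measure: `ν(dx₁) ⋯ ν(dxₙ) = phasePow(x) |ν|(dx₁) ⋯ |ν|(dxₙ)`. -/
def SigmaFiniteComplexMeasure.phasePow (ν : SigmaFiniteComplexMeasure S) {n : ℕ}
    (x : Fin n → S) : ℂ :=
  ∏ i, ν.phase (x i)

/-- The cube `Λⁿ ⊆ Sⁿ`. -/
def cube (Λ : Set S) (n : ℕ) : Set (Fin n → S) :=
  Set.univ.pi fun _ => Λ

/-- `ω_n(x₁,…,xₙ) = ∏_{i<j} w(x_i,x_j)`. -/
def weight (w : S → S → ℂ) {n : ℕ} (x : Fin n → S) : ℂ :=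
  ∏ p : Fin n × Fin n with p.1 < p.2, w (x p.1) (x p.2)

open Classical in
/-- The truncated weight `ω^T_n(x₁,…,xₙ) = ∑_G ∏_{{i,j} ∈ E(G)} (w(x_i,x_j) - 1)`, where `G` ranges
over the connected graphs with vertex set `{1,…,n}`. For `n = 1` the only such graph has no edge,
and the value is `1`. -/
def truncatedWeight (w : S → S → ℂ) {n : ℕ} (x : Fin n → S) : ℂ :=
  ∑ G : SimpleGraph (Fin n) with G.Connected,
    ∏ p : Fin n × Fin n with p.1 < p.2 ∧ G.Adj p.1 p.2, (w (x p.1) (x p.2) - 1)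

/-- `φ_n(x; y₁,…,yₙ) = ∏_i |w(x,y_i) - 1| ∏_{i<j} |w(y_i,y_j)|`. -/
def vertexWeight (w : S → S → ℂ) {n : ℕ} (x : S) (y : Fin n → S) : ℝ≥0∞ :=
  (∏ i, ‖w x (y i) - 1‖ₑ) * ∏ p : Fin n × Fin n with p.1 < p.2, ‖w (y p.1) (y p.2)‖ₑ

/-- The map `Ψ`:
`Ψ(μ)(x) = 1 + ∑_{n ≥ 1} (1/n!) ∫_{Sⁿ} φ_n(x; y) μ(y₁) ⋯ μ(yₙ) |ν|(dy₁) ⋯ |ν|(dyₙ)`. -/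
def vertexSum (w : S → S → ℂ) (ν : SigmaFiniteComplexMeasure S) (μ : S → ℝ≥0∞) (x : S) : ℝ≥0∞ :=
  1 + ∑' k : ℕ, (((k + 1)! : ℕ) : ℝ≥0∞)⁻¹ *
    ∫⁻ y : Fin (k + 1) → S, vertexWeight w x y * ∏ i, μ (y i) ∂ν.variationPow (k + 1)

/-- The density with respect to `|ν|ⁿ` of the `n`-th integral of the pinned expansion at `x`. -/
def pinnedIntegrand (w : S → S → ℂ) (ν : SigmaFiniteComplexMeasure S) (x : S) (n : ℕ)
    (y : Fin n → S) : ℂ :=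
  truncatedWeight w (Fin.cons x y : Fin (n + 1) → S) * ν.phasePow y

/-- The `n`-th term `(1/n!) ∫_{Sⁿ} ω^T_{n+1}(x, y₁,…,yₙ) ν(dy₁) ⋯ ν(dyₙ)` of the pinned expansion;
for `n = 0` it is `ω^T_1(x) = 1`. -/
def pinnedTerm (w : S → S → ℂ) (ν : SigmaFiniteComplexMeasure S) (x : S) (n : ℕ) : ℂ :=
  ((n ! : ℕ) : ℂ)⁻¹ * ∫ y, pinnedIntegrand w ν x n y ∂ν.variationPow n

/-- The pinned cluster expansion `Γ(ν)(x)`. -/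
def pinned (w : S → S → ℂ) (ν : SigmaFiniteComplexMeasure S) (x : S) : ℂ :=
  ∑' n : ℕ, pinnedTerm w ν x n

/-- The absolute pinned cluster expansion
`|Γ|(ν)(x) = ∑_{n ≥ 0} (1/n!) ∫_{Sⁿ} |ω^T_{n+1}(x, y₁,…,yₙ)| |ν|(dy₁) ⋯ |ν|(dyₙ)`. -/
def absPinned (w : S → S → ℂ) (ν : SigmaFiniteComplexMeasure S) (x : S) : ℝ≥0∞ :=
  ∑' n : ℕ, ((n ! : ℕ) : ℝ≥0∞)⁻¹ *
    ∫⁻ y : Fin n → S, ‖truncatedWeight w (Fin.cons x y : Fin (n + 1) → S)‖ₑ ∂ν.variationPow n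

/-- `Ξ_Λ(zν) = 1 + ∑_{n ≥ 1} (zⁿ/n!) ∫_{Λⁿ} ω_n(x₁,…,xₙ) ν(dx₁) ⋯ ν(dxₙ)`;
for `z = 1` this is the partition function `Ξ_Λ(ν)`. -/
def partitionFunction (w : S → S → ℂ) (ν : SigmaFiniteComplexMeasure S) (Λ : Set S) (z : ℂ) : ℂ :=
  1 + ∑' k : ℕ, z ^ (k + 1) / (((k + 1)! : ℕ) : ℂ) *
    ∫ x in cube Λ (k + 1), weight w x * ν.phasePow x ∂ν.variationPow (k + 1)

/-- `ℓ = ln Ξ_Λ(ν)`: the value at `z = 1` of the continuous branch of `z ↦ ln Ξ_Λ(zν)` on the closed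
unit disc that vanishes at `z = 0`. Such a branch exists iff `Ξ_Λ(zν)` has no zero on the disc, and
it is unique. -/
def IsLogPartitionFunction (w : S → S → ℂ) (ν : SigmaFiniteComplexMeasure S) (Λ : Set S) (ℓ : ℂ) :
    Prop :=
  ∃ F : ℂ → ℂ, ContinuousOn F (Metric.closedBall 0 1) ∧ F 0 = 0 ∧
    (∀ z ∈ Metric.closedBall (0 : ℂ) 1, Complex.exp (F z) = partitionFunction w ν Λ z) ∧ F 1 = ℓ

/-- The density with respect to `|ν|ⁿ` of the `n`-th integral of the cluster expansion. -/
def clusterIntegrand (w : S → S → ℂ) (ν : SigmaFiniteComplexMeasure S) (n : ℕ)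
    (x : Fin n → S) : ℂ :=
  truncatedWeight w x * ν.phasePow x

/-- The term `(1/n!) ∫_{Λⁿ} ω^T_n(x₁,…,xₙ) ν(dx₁) ⋯ ν(dxₙ)` of the cluster expansion. -/
def clusterTerm (w : S → S → ℂ) (ν : SigmaFiniteComplexMeasure S) (Λ : Set S) (n : ℕ) : ℂ :=
  ((n ! : ℕ) : ℂ)⁻¹ * ∫ x in cube Λ n, clusterIntegrand w ν n x ∂ν.variationPow n

/-- The absolute cluster expansion
`∑_{n ≥ 1} (1/n!) ∫_{Λⁿ} |ω^T_n(x₁,…,xₙ)| |ν|(dx₁) ⋯ |ν|(dxₙ)`. -/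
def absCluster (w : S → S → ℂ) (ν : SigmaFiniteComplexMeasure S) (Λ : Set S) : ℝ≥0∞ :=
  ∑' k : ℕ, (((k + 1)! : ℕ) : ℝ≥0∞)⁻¹ *
    ∫⁻ x in cube Λ (k + 1), ‖truncatedWeight w x‖ₑ ∂ν.variationPow (k + 1)

end PinnedCluster

end

/-!
Functions of finite configurations are encoded as functions on lists, and convolved by summing over
the ways of splitting a list into two sublists. Integration against the Lebesgue–Poisson measure
`∑ n, |ν|ⁿ / n!` turns convolutions into products, and `f ↦ f (x :: ·)` is a derivation.

Let `W` and `φ` be the weight and the truncated weight. Grouping the graphs on `x :: l` by the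
component of `x` gives `W (x :: ·) = φ (x :: ·) * W`, so that `W` is the convolution exponential of
`φ`. Cancelling `W` after expanding `∏ (1 + (w(x, ·) - 1))` writes `φ (x :: l)` as a sum over the
sets `N` of neighbours of `x`, of `∏ (w(x, y) - 1)` over `N` times `W N` times a convolution product
of the functions `φ (y :: ·)`, `y ∈ N`, damped by further factors `w`. As `|w| ≤ 1`, dropping the
dampings only increases the absolute value. Hence the integrals of `|φ (x :: ·)|` over the lists of
length `< n` are at most `μ x`, by induction on `n`, and so is `|Γ|(ν)(x)`.

As `W` is the exponential of `φ`, the partition function is the exponential of the cluster expansion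
wherever the latter converges absolutely. For convergence, the clusters with a point in
`{|Γ|(ν) ≤ R}` are estimated by pinning that point (Mecke's formula). For `R` large the remaining
part of `Λ` has mass at most `1/8`, and there the constant `2` is a supersolution.
-/

open MeasureTheory
open scoped ENNReal Nat

noncomputable section

namespace PinnedCluster

section ListAlgebra

variable {α R : Type*}

/-- The sum of `K a b` over all ways of splitting a list into two complementary sublists `a` and
`b`, each with the order of its entries kept. -/
def splitSum [AddCommMonoid R] : List α → (List α → List α → R) → R
  | [], K => K [] []
  | x :: l, K => splitSum l (fun a b => K (x :: a) b) + splitSum l (fun a b => K a (x :: b))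

section AddCommMonoid

variable [AddCommMonoid R]

theorem splitSum_congr {l : List α} {K K' : List α → List α → R}
    (h : ∀ a b, (a ++ b).Perm l → K a b = K' a b) : splitSum l K = splitSum l K' := by
  induction l generalizing K K' with
  | nil => exact h [] [] (.refl _)
  | cons x l ih =>
    exact congrArg₂ (· + ·) (ih fun a b hab => h _ _ (hab.cons x))
      (ih fun a b hab => h _ _ (List.perm_middle.trans (hab.cons x)))

theorem splitSum_add (l : List α) (K K' : List α → List α → R) :
    splitSum l (fun a b => K a b + K' a b) = splitSum l K + splitSum l K' := by
  induction l generalizing K K' with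
  | nil => rfl
  | cons x l ih => simpa only [splitSum, ih] using add_add_add_comm _ _ _ _

theorem splitSum_zero (l : List α) : splitSum l (fun _ _ => (0 : R)) = 0 := by
  induction l with
  | nil => rfl
  | cons x l ih => simp only [splitSum, ih, add_zero]

theorem splitSum_comm (l : List α) (K : List α → List α → R) :
    splitSum l K = splitSum l fun a b => K b a := by
  induction l generalizing K with
  | nil => rfl
  | cons x l ih =>
    rw [splitSum, splitSum, ih, ih fun a b => K a (x :: b), add_comm]

theorem splitSum_mono [PartialOrder R] [IsOrderedAddMonoid R] {l : List α}
    {K K' : List α → List α → R} (h : ∀ a b, (a ++ b).Perm l → K a b ≤ K' a b) :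
    splitSum l K ≤ splitSum l K' := by
  induction l generalizing K K' with
  | nil => exact h [] [] (.refl _)
  | cons x l ih =>
    exact add_le_add (ih fun a b hab => h _ _ (hab.cons x))
      (ih fun a b hab => h _ _ (List.perm_middle.trans (hab.cons x)))

end AddCommMonoid

theorem apply_nil_le_splitSum (K : List α → List α → ℝ≥0∞) (l : List α) :
    K [] l ≤ splitSum l K := by
  induction l generalizing K with
  | nil => exact le_rfl
  | cons x l ih => exact (ih fun a b => K a (x :: b)).trans le_add_self

theorem enorm_splitSum_le [TopologicalSpace R] [ESeminormedAddCommMonoid R] (l : List α)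
    (K : List α → List α → R) :
    ‖splitSum l K‖ₑ ≤ splitSum l fun a b => ‖K a b‖ₑ := by
  induction l generalizing K with
  | nil => exact le_rfl
  | cons x l ih =>
    exact (enorm_add_le _ _).trans (add_le_add (ih _) (ih _))

/-- The convolution of two functions of lists over the splittings of a list. When the functions are
symmetric, it corresponds to the product of their exponential generating functionals. -/
def conv [NonUnitalNonAssocSemiring R] (f g : List α → R) (l : List α) : R :=
  splitSum l fun a b => f a * g b

/-- The unit of the convolution: one on the empty list and zero on all others. -/
def convOne [Zero R] [One R] : List α → R
  | [] => 1
  | _ :: _ => 0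

/-- The convolution product of the functions `γ a`, where `a` runs over a list of labels. -/
def convProd {ι : Type*} [Semiring R] (γ : ι → List α → R) : List ι → List α → R
  | [] => convOne
  | a :: N => conv (γ a) (convProd γ N)

section Semiring

variable [Semiring R]

theorem splitSum_const_mul (l : List α) (c : R) (K : List α → List α → R) :
    splitSum l (fun a b => c * K a b) = c * splitSum l K := by
  induction l generalizing K with
  | nil => rfl
  | cons x l ih => simp only [splitSum, ih, mul_add]

theorem splitSum_prod_map {R : Type*} [CommSemiring R] (c : α → R) (l : List α) :
    splitSum l (fun a _ => (a.map c).prod) = (l.map fun x => c x + 1).prod := by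
  induction l with
  | nil => rfl
  | cons x l ih =>
    simp only [splitSum, List.map_cons, List.prod_cons, splitSum_const_mul, ih, add_mul, one_mul]

theorem conv_nil (f g : List α → R) : conv f g [] = f [] * g [] := rfl

/-- The Leibniz rule for the derivations `f ↦ f (x :: ·)`. -/
theorem conv_cons (f g : List α → R) (x : α) (l : List α) :
    conv f g (x :: l) = conv (fun a => f (x :: a)) g l + conv f (fun b => g (x :: b)) l := rfl

theorem conv_congr {f f' g g' : List α → R} {l : List α}
    (hf : ∀ a, a.length ≤ l.length → f a = f' a) (hg : ∀ b, b.length ≤ l.length → g b = g' b) :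
    conv f g l = conv f' g' l :=
  splitSum_congr fun a b hab => by
    have hlen := hab.length_eq
    rw [List.length_append] at hlen
    rw [hf a (by lia), hg b (by lia)]

theorem conv_add_left (f f' g : List α → R) (l : List α) :
    conv (fun a => f a + f' a) g l = conv f g l + conv f' g l := by
  simp only [conv, add_mul, splitSum_add]

theorem conv_const_mul_left (c : R) (f g : List α → R) (l : List α) :
    conv (fun a => c * f a) g l = c * conv f g l := by
  simp only [conv, mul_assoc, splitSum_const_mul]

theorem conv_splitSum (l : List α) (K : List α → List α → R) (f : List α → R) :
    conv (fun c => splitSum c K) f l = splitSum l fun a b => conv (K a) f b := by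
  induction l generalizing K f with
  | nil => rfl
  | cons x l ih =>
    have hcons : (fun c => splitSum (x :: c) K) = fun c =>
        splitSum c (fun a b => K (x :: a) b) + splitSum c (fun a b => K a (x :: b)) := rfl
    rw [conv_cons, hcons, conv_add_left, ih, ih, ih]
    simp only [splitSum, conv_cons, splitSum_add]
    exact add_assoc _ _ _

theorem conv_assoc (f g h : List α → R) (l : List α) :
    conv (conv f g) h l = conv f (conv g h) l := by
  refine (conv_splitSum l (fun a b => f a * g b) h).trans ?_
  simp only [conv_const_mul_left]
  rfl

theorem convOne_conv (f : List α → R) (l : List α) : conv convOne f l = f l := by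
  induction l generalizing f with
  | nil => simp [conv_nil, convOne]
  | cons x l ih =>
    have hzero : conv (fun a : List α => convOne (x :: a)) f l = 0 := by
      simp only [conv, convOne, zero_mul, splitSum_zero]
    rw [conv_cons, ih, hzero, zero_add]

theorem convProd_congr {ι : Type*} {γ γ' : ι → List α → R} {l : List α}
    (h : ∀ x a, a.length ≤ l.length → γ x a = γ' x a) (N : List ι) :
    convProd γ N l = convProd γ' N l := by
  induction N generalizing l with
  | nil => rfl
  | cons x N ih =>
    exact conv_congr (h x) fun b hb => ih fun y a ha => h y a (ha.trans hb)

end Semiring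

section CommSemiring

variable [CommSemiring R]

theorem conv_comm (f g : List α → R) (l : List α) : conv f g l = conv g f l :=
  (splitSum_comm _ _).trans (splitSum_congr fun _ _ _ => mul_comm _ _)

theorem conv_prod_map_mul (c : α → R) (f g : List α → R) (l : List α) :
    conv (fun a => (a.map c).prod * f a) (fun b => (b.map c).prod * g b) l =
      (l.map c).prod * conv f g l := by
  unfold conv
  rw [← splitSum_const_mul]
  refine splitSum_congr fun a b hab => ?_
  rw [← (hab.map c).prod_eq, List.map_append, List.prod_append]
  ring

end CommSemiring

/-- The unit value `k [] = 1` makes `k` invertible for the convolution. -/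
theorem conv_right_cancel [Semiring R] [IsRightCancelAdd R] {f g k : List α → R} (hk : k [] = 1)
    (h : ∀ l, conv f k l = conv g k l) (l : List α) : f l = g l := by
  suffices key : ∀ n : ℕ, ∀ f g : List α → R,
      (∀ l, l.length ≤ n → conv f k l = conv g k l) → ∀ l, l.length ≤ n → f l = g l from
    key l.length f g (fun l _ => h l) l le_rfl
  intro n
  induction n with
  | zero =>
    intro f g hfg l hl
    obtain rfl : l = [] := List.length_eq_zero_iff.1 (Nat.le_zero.1 hl)
    simpa [conv_nil, hk] using hfg [] le_rfl
  | succ n ih =>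
    intro f g hfg
    have hle : ∀ l, l.length ≤ n → f l = g l := ih f g fun l hl => hfg l (hl.trans n.le_succ)
    rintro (_ | ⟨x, l⟩) hl
    · exact hle [] n.zero_le
    · refine ih (fun a => f (x :: a)) (fun a => g (x :: a)) (fun l hl => ?_) l (by simpa using hl)
      have hcons := hfg (x :: l) (by simpa using hl)
      rw [conv_cons, conv_cons, conv_congr (fun a ha => hle a (ha.trans hl)) fun _ _ => rfl]
        at hcons
      exact add_right_cancel hcons

end ListAlgebra

section ListWeights

variable {α R : Type*}

/-- The product of the interactions `w x y` over all pairs of entries of a list, `x` before `y`. -/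
def listWeight [CommMonoid R] (w : α → α → R) : List α → R
  | [] => 1
  | x :: l => (l.map (w x)).prod * listWeight w l

/-- The interaction `∏ w x y`, `x` in the list `N`, of a point `y` with the entries of `N`. -/
def crossWeight [CommMonoid R] (w : α → α → R) (N : List α) (y : α) : R :=
  (N.map fun x => w x y).prod

section CommMonoid

variable [CommMonoid R] {w : α → α → R}

theorem crossWeight_nil : crossWeight w [] = fun _ => 1 := rfl

theorem crossWeight_cons (x : α) (N : List α) :
    crossWeight w (x :: N) = fun y => w x y * crossWeight w N y := rfl

theorem listWeight_append (a b : List α) :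
    listWeight w (a ++ b) = listWeight w a * ((b.map (crossWeight w a)).prod * listWeight w b) := by
  induction a with
  | nil => simp [listWeight, crossWeight_nil]
  | cons x a ih =>
    rw [List.cons_append, listWeight, ih, crossWeight_cons, List.prod_map_mul, List.map_append,
      List.prod_append, listWeight]
    ac_rfl

theorem listWeight_perm (hw : ∀ x y, w x y = w y x) {a b : List α} (h : a.Perm b) :
    listWeight w a = listWeight w b := by
  induction h with
  | nil => rfl
  | cons x h ih => rw [listWeight, listWeight, ih, (h.map _).prod_eq]
  | swap x y l => simp only [listWeight, List.map_cons, List.prod_cons, hw x y]; ac_rfl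
  | trans _ _ ih ih' => exact ih.trans ih'

end CommMonoid

/-- The convolution product of the functions `γ a`, `a` in a list of roots, each damped by the
interaction of its arguments with the subsequent roots. -/
def dampedProd [CommSemiring R] (w : α → α → R) (γ : α → List α → R) : List α → List α → R
  | [] => convOne
  | a :: N => conv (fun l => (l.map (crossWeight w N)).prod * γ a l) (dampedProd w γ N)

theorem conv_dampedProd [CommSemiring R] {w : α → α → R} {γ : α → List α → R}
    (hγ : ∀ x l, conv (γ x) (listWeight w) l = listWeight w (x :: l)) (N l : List α) :
    conv (dampedProd w γ N) (listWeight w) l = (l.map (crossWeight w N)).prod * listWeight w l := by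
  induction N generalizing l with
  | nil => simp [dampedProd, convOne_conv, crossWeight_nil]
  | cons a N ih =>
    rw [dampedProd, conv_assoc, funext ih, conv_prod_map_mul, hγ, crossWeight_cons,
      List.prod_map_mul, listWeight]
    ring

/-- Expand `∏ w x y` over `y ∈ l` into the products of the `w x y - 1`: the set `N` picked is the
set of neighbours of the root `x`. -/
theorem eq_splitSum_dampedProd [CommRing R] {w : α → α → R} (hw : ∀ x y, w x y = w y x)
    {γ : α → List α → R} (hγ : ∀ x l, conv (γ x) (listWeight w) l = listWeight w (x :: l))
    (x : α) (l : List α) :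
    γ x l = splitSum l fun N M =>
      (N.map fun y => w x y - 1).prod * listWeight w N * dampedProd w γ N M := by
  refine conv_right_cancel (g := fun l => splitSum l fun N M =>
    (N.map fun y => w x y - 1).prod * listWeight w N * dampedProd w γ N M)
    (k := listWeight w) rfl (fun l => ?_) l
  have hsplit : ∀ N M : List α, (N ++ M).Perm l →
      (N.map fun y => w x y - 1).prod * listWeight w N *
        ((M.map (crossWeight w N)).prod * listWeight w M) =
      listWeight w l * (N.map fun y => w x y - 1).prod := by
    intro N M hNM
    rw [← listWeight_perm hw hNM, listWeight_append]
    ring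
  rw [hγ, conv_splitSum]
  simp only [conv_const_mul_left, conv_dampedProd hγ]
  rw [splitSum_congr hsplit, splitSum_const_mul, splitSum_prod_map, listWeight, mul_comm]
  simp only [sub_add_cancel]

section NormedField

variable [NormedField R]

theorem enorm_prod_map (c : α → R) (l : List α) :
    ‖(l.map c).prod‖ₑ = (l.map fun y => ‖c y‖ₑ).prod := by
  induction l with
  | nil => simp
  | cons x l ih => simp only [List.map_cons, List.prod_cons, enorm_mul, ih]

theorem enorm_listWeight (w : α → α → R) (l : List α) :
    ‖listWeight w l‖ₑ = listWeight (fun x y => ‖w x y‖ₑ) l := by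
  induction l with
  | nil => simp [listWeight]
  | cons x l ih => rw [listWeight, listWeight, enorm_mul, enorm_prod_map, ih]

theorem enorm_prod_map_le_one {c : α → R} (hc : ∀ y, ‖c y‖ₑ ≤ 1) (l : List α) :
    ‖(l.map c).prod‖ₑ ≤ 1 := by
  induction l with
  | nil => simp
  | cons x l ih =>
    rw [List.map_cons, List.prod_cons, enorm_mul]
    exact mul_le_one' (hc x) ih

theorem enorm_listWeight_le_one {w : α → α → R} (hw : ∀ x y, ‖w x y‖ₑ ≤ 1) (l : List α) :
    ‖listWeight w l‖ₑ ≤ 1 := by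
  induction l with
  | nil => simp [listWeight]
  | cons x l ih =>
    rw [listWeight, enorm_mul]
    exact mul_le_one' (enorm_prod_map_le_one (hw x) l) ih

theorem enorm_conv_le (f g : List α → R) (l : List α) :
    ‖conv f g l‖ₑ ≤ conv (fun a => ‖f a‖ₑ) (fun b => ‖g b‖ₑ) l := by
  refine (enorm_splitSum_le _ _).trans_eq ?_
  simp only [enorm_mul, conv]

theorem conv_mono {f f' g g' : List α → ℝ≥0∞} (hf : ∀ l, f l ≤ f' l) (hg : ∀ l, g l ≤ g' l)
    (l : List α) : conv f g l ≤ conv f' g' l :=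
  splitSum_mono fun a b _ => mul_le_mul' (hf a) (hg b)

theorem enorm_dampedProd_le {w : α → α → R} (hw : ∀ x y, ‖w x y‖ₑ ≤ 1) (γ : α → List α → R)
    (N l : List α) : ‖dampedProd w γ N l‖ₑ ≤ convProd (fun a l => ‖γ a l‖ₑ) N l := by
  induction N generalizing l with
  | nil => cases l <;> simp [dampedProd, convProd, convOne]
  | cons a N ih =>
    refine (enorm_conv_le _ _ l).trans (conv_mono (fun l => ?_) ih l)
    rw [enorm_mul]
    exact mul_le_of_le_one_left' (enorm_prod_map_le_one
      (fun y => enorm_prod_map_le_one (fun x => hw x y) N) l)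

theorem enorm_le_splitSum_convProd {w : α → α → R} (hw_symm : ∀ x y, w x y = w y x)
    (hw : ∀ x y, ‖w x y‖ₑ ≤ 1) {γ : α → List α → R}
    (hγ : ∀ x l, conv (γ x) (listWeight w) l = listWeight w (x :: l)) (x : α) (l : List α) :
    ‖γ x l‖ₑ ≤ splitSum l fun N M =>
      (N.map fun y => ‖w x y - 1‖ₑ).prod * ‖listWeight w N‖ₑ *
        convProd (fun a l => ‖γ a l‖ₑ) N M := by
  rw [eq_splitSum_dampedProd hw_symm hγ]
  refine (enorm_splitSum_le _ _).trans (splitSum_mono fun N M _ => ?_)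
  rw [enorm_mul, enorm_mul, enorm_prod_map]
  gcongr
  exact enorm_dampedProd_le hw γ N M

end NormedField

end ListWeights

section Graphs

variable {V V' R : Type*}

/-- The product of the edge weights `a e` over the edges `e` of a graph. -/
def edgeProd [CommMonoid R] (a : Sym2 V → R) (G : SimpleGraph V) : R :=
  ∏ᶠ e ∈ G.edgeSet, a e

theorem edgeProd_map [CommMonoid R] (f : V ↪ V') (a : Sym2 V' → R) (G : SimpleGraph V) :
    edgeProd a (G.map f) = edgeProd (fun e => a (e.map f)) G := by
  rw [edgeProd, SimpleGraph.edgeSet_map]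
  exact finprod_mem_image (Sym2.map.injective f.injective).injOn

open Classical in
theorem edgeProd_eq_prod [CommMonoid R] [Fintype V] (a : Sym2 V → R) (G : SimpleGraph V) :
    edgeProd a G = ∏ e : Sym2 V with e ∈ G.edgeSet, a e := by
  rw [edgeProd, ← finprod_mem_coe_finset]
  simp

theorem prod_lt_adj_eq_edgeProd [CommMonoid R] [Fintype V] [LinearOrder V] (a : Sym2 V → R)
    (G : SimpleGraph V) [DecidablePred fun p : V × V => p.1 < p.2 ∧ G.Adj p.1 p.2] :
    ∏ p : V × V with p.1 < p.2 ∧ G.Adj p.1 p.2, a s(p.1, p.2) = edgeProd a G := by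
  rw [← finprod_mem_coe_finset, edgeProd]
  refine finprod_mem_eq_of_bijOn (fun p => s(p.1, p.2)) ⟨?_, ?_, ?_⟩ fun _ _ => rfl
  · rintro p hp
    simp_all
  · rintro ⟨i, j⟩ hp ⟨i', j'⟩ hq h
    simp only [Finset.coe_filter, Finset.mem_univ, true_and, Set.mem_ofPred_eq] at hp hq
    rcases Sym2.eq_iff.1 h with ⟨rfl, rfl⟩ | ⟨rfl, rfl⟩
    · rfl
    · exact absurd hp.1 hq.1.asymm
  · rintro ⟨i, j⟩ (hij : G.Adj i j)
    rcases lt_or_gt_of_ne hij.ne with h | h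
    · exact ⟨(i, j), by simp [h, hij], rfl⟩
    · exact ⟨(j, i), by simp [h, hij.symm], Sym2.eq_swap⟩

open Classical in
/-- The sum of the edge products of all connected graphs. -/
def connSum [CommSemiring R] [Fintype V] (a : Sym2 V → R) : R :=
  ∑ G : SimpleGraph V with G.Connected, edgeProd a G

theorem edgeProd_iso [CommMonoid R] {G : SimpleGraph V} {G' : SimpleGraph V'} (f : G ≃g G')
    (a : Sym2 V' → R) : edgeProd (fun e => a (e.map f)) G = edgeProd a G' := by
  rw [edgeProd, edgeProd, ← finprod_set_coe_eq_finprod_mem, ← finprod_set_coe_eq_finprod_mem,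
    ← finprod_comp_equiv f.mapEdgeSet]
  rfl

theorem connSum_comp_equiv [CommSemiring R] [Fintype V] [Fintype V'] (e : V ≃ V')
    (a : Sym2 V' → R) : connSum (fun s => a (s.map e)) = connSum a := by
  classical
  refine (Finset.sum_equiv e.symm.simpleGraph (fun G => ?_) fun G _ => ?_).symm
  · simp only [Finset.mem_filter, Finset.mem_univ, true_and]
    exact (SimpleGraph.Iso.comap e G).connected_iff.symm
  · exact (edgeProd_iso (SimpleGraph.Iso.comap e G) a).symm

theorem sum_edgeProd [CommSemiring R] [Fintype V] [DecidableEq V] (a : Sym2 V → R) :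
    ∑ G : SimpleGraph V, edgeProd a G = edgeProd (fun e => a e + 1) ⊤ := by
  classical
  rw [edgeProd_eq_prod, Finset.prod_add_one]
  simp only [edgeProd_eq_prod]
  refine Finset.sum_bij' (fun G _ => Finset.univ.filter (· ∈ G.edgeSet))
    (fun t _ => SimpleGraph.fromEdgeSet (t : Set (Sym2 V))) ?_ ?_ ?_ ?_ fun _ _ => rfl
  · intro G _
    simpa [Finset.subset_iff] using fun s => @SimpleGraph.edgeSet_mono _ G ⊤ le_top s
  · exact fun t _ => Finset.mem_univ _
  · intro G _
    simp
  · intro t ht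
    ext s
    have hs : s ∈ t → _ := fun hst => Finset.mem_powerset.1 ht hst
    simp_all

/-- The disjoint union of a graph on `A` and a graph on its complement. -/
def glue (A : Finset V) (H : SimpleGraph {i // i ∈ A}) (K : SimpleGraph {i // i ∉ A}) :
    SimpleGraph V :=
  H.map (Function.Embedding.subtype _) ⊔ K.map (Function.Embedding.subtype _)

theorem edgeProd_glue [CommMonoid R] [Finite V] (a : Sym2 V → R) (A : Finset V)
    (H : SimpleGraph {i // i ∈ A}) (K : SimpleGraph {i // i ∉ A}) :
    edgeProd a (glue A H K) =
      edgeProd (fun s => a (s.map Subtype.val)) H *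
        edgeProd (fun s => a (s.map Subtype.val)) K := by
  rw [edgeProd, glue, SimpleGraph.edgeSet_sup,
    finprod_mem_union _ (Set.toFinite _) (Set.toFinite _)]
  · exact congrArg₂ _ (edgeProd_map _ a H) (edgeProd_map _ a K)
  · rw [Set.disjoint_left, Sym2.forall]
    intro i j hH hK
    simp only [SimpleGraph.mem_edgeSet, SimpleGraph.map_adj] at hH hK
    obtain ⟨u, -, -, rfl, -⟩ := hH
    obtain ⟨u', -, -, hu, -⟩ := hK
    exact u'.2 (congrArg (· ∈ A) hu ▸ u.2)

theorem glue_adj {A : Finset V} {H : SimpleGraph {i // i ∈ A}} {K : SimpleGraph {i // i ∉ A}}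
    {i j : V} :
    (glue A H K).Adj i j ↔ (∃ (hi : i ∈ A) (hj : j ∈ A), H.Adj ⟨i, hi⟩ ⟨j, hj⟩) ∨
      ∃ (hi : i ∉ A) (hj : j ∉ A), K.Adj ⟨i, hi⟩ ⟨j, hj⟩ := by
  simp only [glue, SimpleGraph.sup_adj, SimpleGraph.map_adj]
  simp

theorem comap_glue_left (A : Finset V) (H : SimpleGraph {i // i ∈ A})
    (K : SimpleGraph {i // i ∉ A}) : (glue A H K).comap Subtype.val = H := by
  ext i j
  simp [glue_adj]

theorem comap_glue_right (A : Finset V) (H : SimpleGraph {i // i ∈ A})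
    (K : SimpleGraph {i // i ∉ A}) : (glue A H K).comap Subtype.val = K := by
  ext i j
  simp [glue_adj, i.2, j.2]

theorem reachable_glue {A : Finset V} {H : SimpleGraph {i // i ∈ A}}
    {K : SimpleGraph {i // i ∉ A}} (hH : H.Connected) {v : V} (hv : v ∈ A) (u : V) :
    (glue A H K).Reachable v u ↔ u ∈ A := by
  constructor
  · intro h
    rw [SimpleGraph.reachable_iff_reflTransGen] at h
    induction h with
    | refl => exact hv
    | tail _ hadj ih =>
      rcases glue_adj.1 hadj with ⟨_, hj, _⟩ | ⟨hi, _, _⟩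
      · exact hj
      · exact absurd ih hi
  · intro hu
    let f : H →g glue A H K := ⟨Subtype.val, fun {i j} h => glue_adj.2 (.inl ⟨i.2, j.2, h⟩)⟩
    exact (hH.preconnected ⟨v, hv⟩ ⟨u, hu⟩).map f

section Component

variable {A : Finset V} {G : SimpleGraph V} {v : V} (hA : ∀ u, G.Reachable v u ↔ u ∈ A)
include hA

theorem connected_comap_of_reachable_iff :
    (G.comap (Subtype.val : {i // i ∈ A} → V)).Connected := by
  have hcomp : (G.connectedComponentMk v).supp = A := by
    ext u
    simp [← hA, SimpleGraph.ConnectedComponent.eq, SimpleGraph.reachable_comm]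
  have hconn : (G.induce (G.connectedComponentMk v).supp).Connected :=
    (G.connectedComponentMk v).connected_toSimpleGraph
  rw [hcomp] at hconn
  exact hconn

theorem glue_comap_of_reachable_iff :
    glue A (G.comap Subtype.val) (G.comap Subtype.val) = G := by
  ext i j
  rw [glue_adj]
  constructor
  · rintro (⟨_, _, hadj⟩ | ⟨_, _, hadj⟩) <;> exact hadj
  · intro hadj
    by_cases hi : i ∈ A
    · exact .inl ⟨hi, (hA j).1 (((hA i).2 hi).trans hadj.reachable), hadj⟩
    · exact .inr ⟨hi, fun hj => hi ((hA i).1 (((hA j).2 hj).trans hadj.symm.reachable)), hadj⟩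

end Component

open Classical in
theorem sum_edgeProd_of_component [CommSemiring R] [Fintype V] (a : Sym2 V → R)
    {v : V} {A : Finset V} (hv : v ∈ A) :
    ∑ G : SimpleGraph V with ∀ u, G.Reachable v u ↔ u ∈ A, edgeProd a G =
      connSum (fun e : Sym2 {i // i ∈ A} => a (e.map Subtype.val)) *
        edgeProd (fun e : Sym2 {i // i ∉ A} => a (e.map Subtype.val) + 1) ⊤ := by
  rw [← sum_edgeProd, connSum, Finset.sum_mul_sum, ← Finset.sum_product']
  refine Finset.sum_bij' (fun G _ => (G.comap Subtype.val, G.comap Subtype.val))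
    (fun P _ => glue A P.1 P.2) (fun G hG => ?_) (fun P hP => ?_) (fun G hG => ?_)
    (fun P _ => Prod.ext (comap_glue_left A P.1 P.2) (comap_glue_right A P.1 P.2)) fun G hG => ?_
  all_goals simp only [Finset.mem_filter, Finset.mem_univ, true_and, Finset.mem_product,
    and_true] at *
  · exact connected_comap_of_reachable_iff hG
  · exact reachable_glue hP hv
  · exact glue_comap_of_reachable_iff hG
  · rw [← edgeProd_glue, glue_comap_of_reachable_iff hG]

/-- Every graph is the disjoint union of the component of `v` and a graph on the complement. -/
theorem edgeProd_top_eq_sum_connSum [CommSemiring R] [Fintype V] [DecidableEq V] (a : Sym2 V → R)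
    (v : V) :
    edgeProd (fun e => a e + 1) ⊤ = ∑ A : Finset V with v ∈ A,
      connSum (fun e : Sym2 {i // i ∈ A} => a (e.map Subtype.val)) *
        edgeProd (fun e : Sym2 {i // i ∉ A} => a (e.map Subtype.val) + 1) ⊤ := by
  classical
  rw [← sum_edgeProd, ← Finset.sum_fiberwise_of_maps_to
    (g := fun G : SimpleGraph V => Finset.univ.filter fun u => G.Reachable v u)
    (t := Finset.univ.filter fun A : Finset V => v ∈ A) (fun G _ => by simp)]
  refine Finset.sum_congr rfl fun A hA => ?_
  rw [← sum_edgeProd_of_component a (Finset.mem_filter.1 hA).2]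
  exact Finset.sum_congr (by ext; simp [Finset.ext_iff]) fun _ _ => rfl

end Graphs

section TruncatedWeight

variable {α : Type*}

theorem splitSum_map {ι R : Type*} [DecidableEq ι] [AddCommMonoid R] (y : ι → α) {L : List ι}
    (hL : L.Nodup) (K : List α → List α → R) :
    splitSum (L.map y) K = ∑ B ∈ L.toFinset.powerset,
      K ((L.filter (· ∈ B)).map y) ((L.filter (· ∉ B)).map y) := by
  induction L generalizing K with
  | nil => simp [splitSum]
  | cons i L ih =>
    obtain ⟨hi, hL'⟩ := List.nodup_cons.1 hL
    have hi' : i ∉ L.toFinset := by simpa using hi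
    have hne : ∀ j ∈ L, j ≠ i := fun j hj hji => hi (hji ▸ hj)
    rw [List.map_cons, splitSum, ih hL', ih hL', List.toFinset_cons,
      Finset.sum_powerset_insert hi', add_comm]
    refine congrArg₂ (· + ·) (Finset.sum_congr rfl fun B hB => ?_)
      (Finset.sum_congr rfl fun B _ => ?_)
    · have hiB : i ∉ B := fun h => hi' (Finset.mem_powerset.1 hB h)
      simp [hiB]
    · have hmem : L.filter (· ∈ insert i B) = L.filter (· ∈ B) :=
        List.filter_congr fun j hj => by simp [hne j hj]
      have hnotMem : L.filter (· ∉ insert i B) = L.filter (· ∉ B) :=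
        List.filter_congr fun j hj => by simp [hne j hj]
      rw [List.filter_cons_of_pos (by simp), List.filter_cons_of_neg (by simp), hmem, hnotMem,
        List.map_cons]

theorem prod_map_ofFn {M : Type*} [CommMonoid M] (f : α → M) {n : ℕ} (y : Fin n → α) :
    ((List.ofFn y).map f).prod = ∏ i, f (y i) := by
  rw [List.map_ofFn, List.prod_ofFn]
  rfl

theorem prod_lt_succ {M : Type*} [CommMonoid M] {n : ℕ} (f : Fin (n + 1) → Fin (n + 1) → M) :
    ∏ p : Fin (n + 1) × Fin (n + 1) with p.1 < p.2, f p.1 p.2 =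
      (∏ j : Fin n, f 0 j.succ) * ∏ p : Fin n × Fin n with p.1 < p.2, f p.1.succ p.2.succ := by
  simp only [Finset.prod_filter, Fintype.prod_prod_type, Fin.prod_univ_succ, Fin.succ_lt_succ_iff,
    Fin.succ_pos, Fin.not_lt_zero, if_true, if_false, one_mul]

theorem listWeight_ofFn {M : Type*} [CommMonoid M] (w : α → α → M) {n : ℕ} (y : Fin n → α) :
    listWeight w (List.ofFn y) = ∏ p : Fin n × Fin n with p.1 < p.2, w (y p.1) (y p.2) := by
  induction n with
  | zero => simp [listWeight]
  | succ n ih =>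
    rw [List.ofFn_succ, listWeight, ih, prod_map_ofFn, prod_lt_succ fun i j => w (y i) (y j)]

/-- The truncated weight of the entries of a list. -/
def listTrunc (w : α → α → ℂ) (l : List α) : ℂ := truncatedWeight w l.get

theorem listTrunc_nil (w : α → α → ℂ) : listTrunc w [] = 0 := by
  have hempty : ∀ G : SimpleGraph (Fin ([] : List α).length), ¬G.Connected := fun G hG =>
    hG.nonempty.elim fun i => i.elim0
  simp [listTrunc, truncatedWeight, hempty]

theorem listTrunc_ofFn (w : α → α → ℂ) {n : ℕ} (y : Fin n → α) :
    listTrunc w (List.ofFn y) = truncatedWeight w y := by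
  suffices key : ∀ (l : List α) (h : l.length = n), (∀ i : Fin n, l.get (i.cast h.symm) = y i) →
      truncatedWeight w l.get = truncatedWeight w y from
    key _ List.length_ofFn fun i => by simp
  rintro l rfl hl
  exact congrArg _ (funext hl)

/-- The symmetric interaction `w` as a function of unordered pairs. -/
def pairWeight (w : α → α → ℂ) (hw : ∀ x y, w x y = w y x) : Sym2 α → ℂ :=
  Sym2.lift ⟨w, hw⟩

variable {w : α → α → ℂ} (hw : ∀ x y, w x y = w y x)

theorem truncatedWeight_eq_connSum {n : ℕ} (y : Fin n → α) :
    truncatedWeight w y = connSum fun e => pairWeight w hw (e.map y) - 1 := by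
  classical
  refine Finset.sum_congr (by ext; simp) fun G _ => ?_
  rw [← prod_lt_adj_eq_edgeProd]
  exact Finset.prod_congr (by ext; simp) fun p _ => rfl

theorem weight_eq_edgeProd {n : ℕ} (y : Fin n → α) :
    weight w y = edgeProd (fun e => pairWeight w hw (e.map y)) ⊤ := by
  classical
  rw [← prod_lt_adj_eq_edgeProd]
  refine Finset.prod_congr ?_ fun p _ => rfl
  ext p
  simpa using fun h => ne_of_lt h

section Enumeration

variable {ι κ : Type*} (z : ι → α) {L : List ι} (hL : L.Nodup) {f : κ → ι}
  (hf : f.Injective) (hLf : ∀ i, i ∈ L ↔ i ∈ Set.range f)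
include hL hf hLf

theorem exists_equiv_get_map : ∃ e : Fin (L.map z).length ≃ κ, ∀ s,
    Sym2.map (L.map z).get s = ((s.map e).map f).map z := by
  classical
  let e := (finCongr (List.length_map z)).trans ((hL.getEquiv L).trans
    ((Equiv.subtypeEquivRight hLf).trans (Equiv.ofInjective f hf).symm))
  have he : (L.map z).get = z ∘ f ∘ e := funext fun i => by
    simp [e, Equiv.apply_ofInjective_symm]
  exact ⟨e, fun s => by rw [he, Sym2.map_map, Sym2.map_map]; rfl⟩

theorem listTrunc_map [Fintype κ] :
    listTrunc w (L.map z) = connSum fun e : Sym2 κ => pairWeight w hw ((e.map f).map z) - 1 := by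
  obtain ⟨e, he⟩ := exists_equiv_get_map z hL hf hLf
  rw [listTrunc, truncatedWeight_eq_connSum hw, ← connSum_comp_equiv e]
  simp only [he]

theorem listWeight_map :
    listWeight w (L.map z) =
      edgeProd (fun e : Sym2 κ => pairWeight w hw ((e.map f).map z)) ⊤ := by
  obtain ⟨e, he⟩ := exists_equiv_get_map z hL hf hLf
  have hweight := (listWeight_ofFn w (L.map z).get).trans (weight_eq_edgeProd hw _)
  rw [List.ofFn_get] at hweight
  rw [hweight, ← edgeProd_iso (SimpleGraph.Iso.completeGraph e)]
  simp only [he]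
  rfl

end Enumeration

include hw

theorem listTrunc_perm {l l' : List α} (h : l.Perm l') : listTrunc w l = listTrunc w l' := by
  obtain ⟨n, y, rfl⟩ : ∃ (n : ℕ) (y : Fin n → α), l' = (List.finRange n).map y :=
    ⟨l'.length, l'.get, by simp⟩
  have hcomp : Relation.Comp (fun a b => a = List.map y b) List.Perm l (List.finRange n) := by
    rwa [List.eq_map_comp_perm]
  obtain ⟨L, rfl, hL⟩ := hcomp
  have hfin := List.nodup_finRange n
  rw [listTrunc_map hw y hfin Function.injective_id (by simp),
    listTrunc_map hw y (hL.nodup_iff.2 hfin) Function.injective_id (by simp [hL.mem_iff])]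

/-- Group the graphs on the root `x` and the points of `l` by the connected component of `x`. -/
theorem conv_listTrunc (x : α) (l : List α) :
    conv (fun a => listTrunc w (x :: a)) (listWeight w) l = listWeight w (x :: l) := by
  classical
  obtain ⟨n, y, rfl⟩ : ∃ (n : ℕ) (y : Fin n → α), l = (List.finRange n).map y :=
    ⟨l.length, l.get, by simp⟩
  have hsome : ∀ L : List (Fin n), L.map y = (L.map some).map (Option.elim · x y) :=
    fun L => by simp
  have hnone : ∀ L : List (Fin n), x :: L.map y = (none :: L.map some).map (Option.elim · x y) :=
    fun L => by simp
  have hnodup : ∀ L : List (Fin n), L.Nodup → (none :: L.map some : List (Option (Fin n))).Nodup :=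
    fun L hL => by simpa using hL.map (Option.some_injective _)
  have hfin := List.nodup_finRange n
  rw [conv, splitSum_map _ hfin, hnone, listWeight_map hw _ (hnodup _ hfin) (f := id)
    Function.injective_id (by rintro (_ | i) <;> simp)]
  have hcomponent := edgeProd_top_eq_sum_connSum
    (fun e : Sym2 (Option (Fin n)) => pairWeight w hw (e.map (Option.elim · x y)) - 1) none
  simp only [sub_add_cancel] at hcomponent
  rw [Sym2.map_id]
  simp only [id_eq, hcomponent]
  refine Finset.sum_bij' (fun B _ => Finset.insertNone B) (fun A _ => Finset.eraseNone A)
    (by simp) (by simp) (by simp) (fun A hA => ?_) fun B _ => ?_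
  · have hnoneA : none ∈ A := by simpa using hA
    simp [hnoneA]
  · rw [hnone, hsome, listTrunc_map hw _ (hnodup _ (hfin.filter _))
      (κ := {i // i ∈ B.insertNone}) Subtype.val_injective,
      listWeight_map hw _ ((hfin.filter _).map (Option.some_injective _))
      (κ := {i // i ∉ B.insertNone}) Subtype.val_injective]
    · rintro (_ | i) <;> simp
    · rintro (_ | i) <;> simp

end TruncatedWeight

section MeasurableLists

variable {S T E : Type*} [MeasurableSpace S] [MeasurableSpace T] [MeasurableSpace E]

/-- The σ-algebra on lists for which a set is measurable when, for every `n`, the lists of length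
`n` in it form a measurable subset of `Sⁿ`. -/
instance instMeasurableSpaceList : MeasurableSpace (List S) :=
  ⨅ n, MeasurableSpace.map (List.ofFn (n := n)) inferInstance

theorem measurableSet_list_iff {A : Set (List S)} :
    MeasurableSet A ↔ ∀ n, MeasurableSet (List.ofFn (n := n) ⁻¹' A) :=
  MeasurableSpace.measurableSet_iInf

theorem measurableEmbedding_ofFn (n : ℕ) : MeasurableEmbedding (List.ofFn (n := n) (α := S)) where
  injective := List.ofFn_injective
  measurable := fun _ hA => measurableSet_list_iff.1 hA n
  measurableSet_image' := fun A hA => measurableSet_list_iff.2 fun m => by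
    obtain rfl | hmn := eq_or_ne m n
    · rwa [Set.preimage_image_eq _ List.ofFn_injective]
    · convert MeasurableSet.empty
      refine Set.eq_empty_of_forall_notMem fun y ⟨y', _, hy⟩ => hmn ?_
      simpa using (congrArg List.length hy).symm

theorem measurable_list_iff {f : List S → E} :
    Measurable f ↔ ∀ n, Measurable fun y : Fin n → S => f (List.ofFn y) :=
  ⟨fun hf n => hf.comp (measurableEmbedding_ofFn n).measurable,
    fun hf _ hA => measurableSet_list_iff.2 fun n => hf n hA⟩

theorem measurable_prod_list_iff {f : T × List S → E} :
    Measurable f ↔ ∀ n, Measurable fun q : T × (Fin n → S) => f (q.1, List.ofFn q.2) := by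
  have hemb : ∀ n, MeasurableEmbedding fun q : T × (Fin n → S) => (q.1, List.ofFn q.2) := fun n =>
    MeasurableEmbedding.id.prodMap (measurableEmbedding_ofFn n)
  refine ⟨fun hf n => hf.comp (hemb n).measurable, fun hf A hA => ?_⟩
  have hcover : f ⁻¹' A = ⋃ n, (fun q : T × (Fin n → S) => (q.1, List.ofFn q.2)) ''
      ((fun q : T × (Fin n → S) => f (q.1, List.ofFn q.2)) ⁻¹' A) := by
    ext ⟨t, l⟩
    refine ⟨fun h => Set.mem_iUnion.2 ⟨l.length, (t, l.get), by simpa using h, by simp⟩, ?_⟩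
    intro h
    obtain ⟨n, q, hq, heq⟩ := Set.mem_iUnion.1 h
    exact heq ▸ hq
  rw [hcover]
  exact .iUnion fun n => (hemb n).measurableSet_image.2 (hf n hA)

@[fun_prop]
theorem measurable_cons : Measurable fun q : S × List S => q.1 :: q.2 := by
  refine measurable_prod_list_iff.2 fun n => ?_
  have hcons : Measurable fun q : S × (Fin n → S) => (Fin.cons q.1 q.2 : Fin (n + 1) → S) :=
    measurable_pi_iff.2 (Fin.cases measurable_fst fun j =>
      (measurable_pi_apply j).comp measurable_snd)
  simpa [Function.comp_def] using (measurableEmbedding_ofFn (n + 1)).measurable.comp hcons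

theorem measurable_list_map {n : ℕ} (L : List (Fin n)) :
    Measurable fun y : Fin n → S => L.map y := by
  induction L with
  | nil => exact measurable_const
  | cons i L ih => exact measurable_cons.comp ((measurable_pi_apply i).prodMk ih)

@[fun_prop]
theorem measurable_prod_map [CommMonoid E] [MeasurableMul₂ E] {c : S → E} (hc : Measurable c) :
    Measurable fun l : List S => (l.map c).prod := by
  refine measurable_list_iff.2 fun n => ?_
  simp only [prod_map_ofFn]
  fun_prop

theorem measurable_splitSum_prod [AddCommMonoid E] [MeasurableAdd₂ E]
    {K : T → List S → List S → E}
    (hK : Measurable fun q : T × List S × List S => K q.1 q.2.1 q.2.2) :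
    Measurable fun q : T × List S => splitSum q.2 (K q.1) := by
  refine measurable_prod_list_iff.2 fun n => ?_
  simp only [List.ofFn_eq_map, splitSum_map _ (List.nodup_finRange n)]
  exact Finset.measurable_fun_sum _ fun B _ => hK.comp (measurable_fst.prodMk
    (((measurable_list_map _).comp measurable_snd).prodMk
      ((measurable_list_map _).comp measurable_snd)))

theorem measurable_splitSum [AddCommMonoid E] [MeasurableAdd₂ E] {K : List S → List S → E}
    (hK : Measurable fun q : List S × List S => K q.1 q.2) : Measurable fun l => splitSum l K :=
  (measurable_splitSum_prod (T := Unit) (K := fun _ => K) (hK.comp measurable_snd)).comp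
    (measurable_const (a := ()) |>.prodMk measurable_id)

theorem measurable_conv [NonUnitalNonAssocSemiring E] [MeasurableAdd₂ E] [MeasurableMul₂ E]
    {f g : List S → E} (hf : Measurable f) (hg : Measurable g) : Measurable (conv f g) :=
  measurable_splitSum (by fun_prop)

theorem measurable_convOne [Zero E] [One E] : Measurable (convOne : List S → E) :=
  measurable_list_iff.2 fun n => by cases n <;> simp [convOne]

theorem measurable_convProd_prod [Semiring E] [MeasurableAdd₂ E] [MeasurableMul₂ E]
    {γ : T → List S → E} (hγ : Measurable fun q : T × List S => γ q.1 q.2) :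
    Measurable fun q : List T × List S => convProd γ q.1 q.2 := by
  suffices h : ∀ n, Measurable fun q : (Fin n → T) × List S => convProd γ (List.ofFn q.1) q.2 from
    (measurable_prod_list_iff (f := fun q : List S × List T => convProd γ q.2 q.1).2
      fun n => (h n).comp measurable_swap).comp measurable_swap
  intro n
  induction n with
  | zero =>
    simp only [List.ofFn_zero, convProd]
    exact measurable_convOne.comp measurable_snd
  | succ n ih =>
    have hhead : Measurable fun q : (Fin (n + 1) → T) × List S × List S => (q.1 0, q.2.1) := by
      fun_prop
    have htail : Measurable fun q : (Fin (n + 1) → T) × List S × List S =>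
        (fun i : Fin n => q.1 i.succ, q.2.2) := by fun_prop
    simp only [List.ofFn_succ, convProd]
    exact measurable_splitSum_prod (K := fun (y : Fin (n + 1) → T) a b => γ (y 0) a *
      convProd γ (List.ofFn fun i : Fin n => y i.succ) b) ((hγ.comp hhead).mul (ih.comp htail))

theorem measurable_convProd [Semiring E] [MeasurableAdd₂ E] [MeasurableMul₂ E] {ι : Type*}
    {γ : ι → List S → E} (hγ : ∀ i, Measurable (γ i)) (N : List ι) : Measurable (convProd γ N) := by
  induction N with
  | nil => exact measurable_convOne
  | cons a N ih => exact measurable_conv (hγ a) ih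

end MeasurableLists

section LebesguePoisson

variable {S E : Type*} [MeasurableSpace S]

/-- The product measure `ρⁿ`, as a measure on lists. -/
def listPi (ρ : Measure S) (n : ℕ) : Measure (List S) :=
  (Measure.pi fun _ : Fin n => ρ).map List.ofFn

/-- The Lebesgue–Poisson measure `∑ n, ρⁿ / n!` on the lists of points of `S`. The expansions of the
theorem are integrals with respect to it. -/
def lebesguePoisson (ρ : Measure S) : Measure (List S) :=
  .sum fun n => ((n ! : ℕ) : ℝ≥0∞)⁻¹ • listPi ρ n

theorem lintegral_lebesguePoisson (ρ : Measure S) (f : List S → ℝ≥0∞) :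
    ∫⁻ l, f l ∂lebesguePoisson ρ =
      ∑' n : ℕ, ((n ! : ℕ) : ℝ≥0∞)⁻¹ *
        ∫⁻ y : Fin n → S, f (List.ofFn y) ∂Measure.pi fun _ => ρ := by
  simp only [lebesguePoisson, listPi, lintegral_sum_measure, lintegral_smul_measure,
    (measurableEmbedding_ofFn _).lintegral_map, smul_eq_mul]

theorem integrable_comp_ofFn [NormedAddCommGroup E] {ρ : Measure S} {f : List S → E}
    (hf : Integrable f (lebesguePoisson ρ)) (n : ℕ) :
    Integrable (fun y : Fin n → S => f (List.ofFn y)) (Measure.pi fun _ => ρ) := by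
  have hn := hf.mono_measure (Measure.le_sum _ n)
  rwa [integrable_smul_measure (by simp) (by simp [Nat.factorial_ne_zero]), listPi,
    (measurableEmbedding_ofFn n).integrable_map_iff] at hn

theorem hasSum_integral_lebesguePoisson {𝕜 : Type*} [RCLike 𝕜] {ρ : Measure S} {f : List S → 𝕜}
    (hf : Integrable f (lebesguePoisson ρ)) :
    HasSum (fun n : ℕ => ((n ! : ℕ) : 𝕜)⁻¹ *
        ∫ y : Fin n → S, f (List.ofFn y) ∂Measure.pi fun _ => ρ)
      (∫ l, f l ∂lebesguePoisson ρ) := by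
  refine (hasSum_integral_measure hf).congr_fun fun n => ?_
  rw [integral_smul_measure, listPi, (measurableEmbedding_ofFn n).integral_map, ENNReal.toReal_inv,
    ENNReal.toReal_natCast, RCLike.real_smul_eq_coe_mul, RCLike.ofReal_inv,
    RCLike.ofReal_natCast]

theorem enorm_inv_factorial (𝕜 : Type*) [RCLike 𝕜] (n : ℕ) :
    ‖((n ! : ℕ) : 𝕜)⁻¹‖ₑ = ((n ! : ℕ) : ℝ≥0∞)⁻¹ := by
  rw [enorm_inv (by exact_mod_cast n.factorial_ne_zero), enorm_eq_nnnorm, RCLike.nnnorm_natCast,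
    ENNReal.coe_natCast]

theorem tsum_enorm_integral_le {𝕜 : Type*} [RCLike 𝕜] (ρ : Measure S) (f : List S → 𝕜) :
    ∑' n : ℕ, ‖((n ! : ℕ) : 𝕜)⁻¹ * ∫ y : Fin n → S, f (List.ofFn y) ∂Measure.pi fun _ => ρ‖ₑ ≤
      ∫⁻ l, ‖f l‖ₑ ∂lebesguePoisson ρ := by
  rw [lintegral_lebesguePoisson]
  refine ENNReal.tsum_le_tsum fun n => ?_
  rw [enorm_mul, enorm_inv_factorial]
  gcongr
  exact enorm_integral_le_lintegral_enorm _

instance sFinite_listPi (ρ : Measure S) [SigmaFinite ρ] (n : ℕ) : SFinite (listPi ρ n) := by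
  unfold listPi
  infer_instance

instance sFinite_lebesguePoisson (ρ : Measure S) [SigmaFinite ρ] : SFinite (lebesguePoisson ρ) := by
  unfold lebesguePoisson
  infer_instance

theorem lebesguePoisson_restrict (ρ : Measure S) [SigmaFinite ρ] (Λ : Set S) :
    lebesguePoisson (ρ.restrict Λ) = (lebesguePoisson ρ).restrict {l | ∀ x ∈ l, x ∈ Λ} := by
  rw [lebesguePoisson, lebesguePoisson, Measure.restrict_sum_of_countable]
  refine congrArg Measure.sum (funext fun n => ?_)
  have hpre : List.ofFn (n := n) ⁻¹' {l | ∀ x ∈ l, x ∈ Λ} = Set.univ.pi fun _ => Λ := by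
    ext y
    simp
  rw [Measure.restrict_smul, listPi, listPi, (measurableEmbedding_ofFn n).restrict_map, hpre,
    Measure.restrict_pi_pi]

section Splitting

/-- The entries of a configuration with index in `B`, and the remaining ones. -/
def splitAt {S : Type*} {n : ℕ} (B : Finset (Fin n)) (y : Fin n → S) : List S × List S :=
  (((List.finRange n).filter (· ∈ B)).map y, ((List.finRange n).filter (· ∉ B)).map y)

theorem splitSum_ofFn {S : Type*} [AddCommMonoid E] {n : ℕ} (y : Fin n → S)
    (K : List S → List S → E) :
    splitSum (List.ofFn y) K = ∑ B : Finset (Fin n), K (splitAt B y).1 (splitAt B y).2 := by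
  rw [List.ofFn_eq_map, splitSum_map _ (List.nodup_finRange n), List.toFinset_finRange,
    Finset.powerset_univ]
  rfl

theorem measurable_splitAt {n : ℕ} (B : Finset (Fin n)) : Measurable (splitAt (S := S) B) :=
  (measurable_list_map _).prodMk (measurable_list_map _)

theorem measurePreserving_comp_get {ι : Type*} [Fintype ι] (ρ : Measure S) [SigmaFinite ρ]
    {L L' : List ι} (h : Function.Bijective (Sum.elim L.get L'.get)) :
    MeasurePreserving (fun y : ι → S => (fun i => y (L.get i), fun i => y (L'.get i)))
      (Measure.pi fun _ => ρ) ((Measure.pi fun _ => ρ).prod (Measure.pi fun _ => ρ)) :=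
  (measurePreserving_sumPiEquivProdPi fun _ => ρ).comp
    (measurePreserving_piCongrLeft (fun _ => ρ) (Equiv.ofBijective _ h)).symm

theorem measurePreserving_splitAt (ρ : Measure S) [SigmaFinite ρ] {n : ℕ} (B : Finset (Fin n)) :
    MeasurePreserving (splitAt B) (Measure.pi fun _ : Fin n => ρ)
      ((listPi ρ B.card).prod (listPi ρ (n - B.card))) := by
  set L := (List.finRange n).filter (· ∈ B)
  set L' := (List.finRange n).filter (· ∉ B)
  have hcard : L.length = B.card := by
    rw [← List.toFinset_card_of_nodup ((List.nodup_finRange n).filter _)]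
    exact congrArg _ (by ext; simp)
  have hcard' : L'.length = n - B.card := by
    have hcompl : Bᶜ.card = n - B.card := by rw [Finset.card_compl, Fintype.card_fin]
    rw [← List.toFinset_card_of_nodup ((List.nodup_finRange n).filter _), ← hcompl]
    exact congrArg _ (by ext; simp)
  have hinj : Function.Injective (Sum.elim L.get L'.get) :=
    Function.Injective.sumElim (((List.nodup_finRange n).filter _).injective_get)
      (((List.nodup_finRange n).filter _).injective_get) fun i j hij => by
        have hi := List.of_mem_filter (List.get_mem L i)
        have hj := List.of_mem_filter (List.get_mem L' j)
        simp_all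
  have hbij : Function.Bijective (Sum.elim L.get L'.get) :=
    (Fintype.bijective_iff_injective_and_card _).2 ⟨hinj, by
      have := B.card_le_univ
      simp_all⟩
  have hofFn : ∀ m, MeasurePreserving List.ofFn (Measure.pi fun _ : Fin m => ρ) (listPi ρ m) :=
    fun m => ⟨(measurableEmbedding_ofFn m).measurable, rfl⟩
  have hmap : ∀ (K : List (Fin n)) (y : Fin n → S), K.map y = List.ofFn fun i => y (K.get i) :=
    fun K y => by rw [← Function.comp_def, ← List.map_ofFn, List.ofFn_get]
  have hsplit : splitAt B = Prod.map List.ofFn List.ofFn ∘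
      fun y : Fin n → S => (fun i => y (L.get i), fun i => y (L'.get i)) :=
    funext fun y => Prod.ext (hmap L y) (hmap L' y)
  rw [← hcard', ← hcard, hsplit]
  exact ((hofFn _).prod (hofFn _)).comp (measurePreserving_comp_get ρ hbij)

theorem inv_factorial_mul_choose {n i j : ℕ} (h : i + j = n) :
    ((n ! : ℕ) : ℝ≥0∞)⁻¹ * (n.choose i : ℝ≥0∞) =
      ((i ! : ℕ) : ℝ≥0∞)⁻¹ * ((j ! : ℕ) : ℝ≥0∞)⁻¹ := by
  subst h
  have hne : ∀ k : ℕ, ((k ! : ℕ) : ℝ≥0∞) ≠ 0 := fun k => by exact_mod_cast k.factorial_ne_zero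
  have hfin : ∀ k : ℕ, (k : ℝ≥0∞) ≠ ⊤ := ENNReal.natCast_ne_top
  have hchoose : ((i + j).choose i : ℝ≥0∞) * ((i ! : ℕ) * (j ! : ℕ)) = ((i + j)! : ℕ) := by
    rw [Nat.choose_symm_add, ← mul_assoc]
    exact_mod_cast Nat.add_choose_mul_factorial_mul_factorial i j
  rw [← ENNReal.mul_inv (.inl (hne i)) (.inl (hfin _))]
  refine ENNReal.eq_inv_of_mul_eq_one_left ?_
  rw [mul_assoc, hchoose, ENNReal.inv_mul_cancel (hne _) (hfin _)]

theorem lebesguePoisson_prod_self (ρ : Measure S) [SigmaFinite ρ] :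
    (lebesguePoisson ρ).prod (lebesguePoisson ρ) = .sum fun p : Σ n, Finset (Fin n) =>
      ((p.1 ! : ℕ) : ℝ≥0∞)⁻¹ • (Measure.pi fun _ : Fin p.1 => ρ).map (splitAt p.2) := by
  rw [lebesguePoisson, Measure.prod_sum]
  ext A hA
  rw [Measure.sum_apply _ hA, Measure.sum_apply _ hA, ENNReal.tsum_sigma',
    ← Finset.HasAntidiagonal.sigmaAntidiagonalEquivProd.tsum_eq, ENNReal.tsum_sigma']
  refine tsum_congr fun n => ?_
  have hterm : ∀ i j : ℕ,
      (((i ! : ℕ) : ℝ≥0∞)⁻¹ • listPi ρ i).prod (((j ! : ℕ) : ℝ≥0∞)⁻¹ • listPi ρ j) A =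
        ((i ! : ℕ) : ℝ≥0∞)⁻¹ * ((j ! : ℕ) : ℝ≥0∞)⁻¹ *
          (listPi ρ i).prod (listPi ρ j) A := fun i j => by
    rw [Measure.prod_smul_left, Measure.prod_smul_right, Measure.smul_apply, Measure.smul_apply,
      smul_eq_mul, smul_eq_mul, mul_assoc]
  set P : ℕ → ℝ≥0∞ := fun i => (listPi ρ i).prod (listPi ρ (n - i)) A
  have hsubsets :
      ∑ B : Finset (Fin n), P B.card = ∑ i ∈ Finset.range (n + 1), n.choose i * P i := by
    rw [← Finset.powerset_univ, Finset.sum_powerset_apply_card, Finset.card_fin]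
    simp only [nsmul_eq_mul]
  simp only [tsum_fintype, (measurePreserving_splitAt ρ _).map_eq, Measure.smul_apply, smul_eq_mul,
    ← Finset.mul_sum, Finset.HasAntidiagonal.sigmaAntidiagonalEquivProd_apply, hterm]
  rw [hsubsets, Finset.mul_sum, ← Finset.Nat.sum_antidiagonal_eq_sum_range_succ_mk
    (fun p => ((n ! : ℕ) : ℝ≥0∞)⁻¹ * (n.choose p.1 * P p.1)),
    ← Finset.sum_coe_sort (Finset.HasAntidiagonal.antidiagonal n)]
  refine Fintype.sum_congr _ _ fun p => ?_
  have hp := Finset.HasAntidiagonal.mem_antidiagonal.1 p.2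
  rw [← mul_assoc, inv_factorial_mul_choose hp]
  simp only [P, ← Nat.eq_sub_of_add_eq' hp]

theorem lintegral_splitSum (ρ : Measure S) [SigmaFinite ρ] {K : List S → List S → ℝ≥0∞}
    (hK : Measurable fun q : List S × List S => K q.1 q.2) :
    ∫⁻ l, splitSum l K ∂lebesguePoisson ρ =
      ∫⁻ a, ∫⁻ b, K a b ∂lebesguePoisson ρ ∂lebesguePoisson ρ := by
  rw [← lintegral_prod (fun q => K q.1 q.2) hK.aemeasurable, lebesguePoisson_prod_self,
    lintegral_sum_measure, ENNReal.tsum_sigma', lintegral_lebesguePoisson]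
  refine tsum_congr fun n => ?_
  simp only [splitSum_ofFn, tsum_fintype, lintegral_smul_measure, smul_eq_mul,
    lintegral_map hK (measurable_splitAt _), ← Finset.mul_sum]
  exact congrArg _ (lintegral_finsetSum _ fun B _ => hK.comp (measurable_splitAt B))

end Splitting
end LebesguePoisson

section IntegralConv

variable {S 𝕜 : Type*} [MeasurableSpace S] {ρ : Measure S} [SigmaFinite ρ] [RCLike 𝕜]

theorem lintegral_conv {f g : List S → ℝ≥0∞} (hf : Measurable f) (hg : Measurable g) :
    ∫⁻ l, conv f g l ∂lebesguePoisson ρ =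
      (∫⁻ l, f l ∂lebesguePoisson ρ) * ∫⁻ l, g l ∂lebesguePoisson ρ := by
  unfold conv
  rw [lintegral_splitSum ρ (by fun_prop)]
  simp only [lintegral_const_mul _ hg, lintegral_mul_const _ hf]

theorem lintegral_convOne (ρ : Measure S) : ∫⁻ l, convOne l ∂lebesguePoisson ρ = 1 := by
  rw [lintegral_lebesguePoisson, tsum_eq_single 0 fun n hn => by
    obtain ⟨m, rfl⟩ := Nat.exists_eq_succ_of_ne_zero hn
    simp [convOne]]
  simp [convOne]

theorem lintegral_convProd {ι : Type*} {γ : ι → List S → ℝ≥0∞} (hγ : ∀ i, Measurable (γ i))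
    (N : List ι) :
    ∫⁻ l, convProd γ N l ∂lebesguePoisson ρ =
      (N.map fun i => ∫⁻ l, γ i l ∂lebesguePoisson ρ).prod := by
  induction N with
  | nil => exact lintegral_convOne ρ
  | cons i N ih =>
    rw [List.map_cons, List.prod_cons, ← ih]
    exact lintegral_conv (hγ i) (measurable_convProd hγ N)

theorem integrable_splitSum {K : List S → List S → 𝕜}
    (hK_meas : Measurable fun q : List S × List S => K q.1 q.2)
    (hK : Integrable (fun q : List S × List S => K q.1 q.2)
      ((lebesguePoisson ρ).prod (lebesguePoisson ρ))) :
    Integrable (fun l => splitSum l K) (lebesguePoisson ρ) := by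
  refine ⟨(measurable_splitSum hK_meas).aestronglyMeasurable, ?_⟩
  refine (lintegral_mono fun l => enorm_splitSum_le l K).trans_lt ?_
  rw [lintegral_splitSum ρ hK_meas.enorm, ← lintegral_prod _ hK_meas.enorm.aemeasurable]
  exact hK.hasFiniteIntegral

theorem integral_splitSum {K : List S → List S → 𝕜}
    (hK_meas : Measurable fun q : List S × List S => K q.1 q.2)
    (hK : Integrable (fun q : List S × List S => K q.1 q.2)
      ((lebesguePoisson ρ).prod (lebesguePoisson ρ))) :
    ∫ l, splitSum l K ∂lebesguePoisson ρ =
      ∫ q, K q.1 q.2 ∂(lebesguePoisson ρ).prod (lebesguePoisson ρ) := by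
  refine (hasSum_integral_lebesguePoisson (integrable_splitSum hK_meas hK)).unique ?_
  have hsummand := hK
  rw [lebesguePoisson_prod_self] at hsummand ⊢
  refine ((hasSum_integral_measure hsummand).sigma fun n => hasSum_fintype _).congr_fun fun n => ?_
  have hint : ∀ B : Finset (Fin n), Integrable
      (fun y : Fin n → S => K (splitAt B y).1 (splitAt B y).2) (Measure.pi fun _ => ρ) := by
    intro B
    have hB := hsummand.mono_measure (Measure.le_sum _ ⟨n, B⟩)
    rwa [integrable_smul_measure (by simp) (by simp [Nat.factorial_ne_zero]),
      integrable_map_measure hK_meas.aestronglyMeasurable (measurable_splitAt B).aemeasurable] at hB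
  simp only [splitSum_ofFn, integral_smul_measure, ← Finset.smul_sum,
    integral_map (measurable_splitAt _).aemeasurable hK_meas.aestronglyMeasurable]
  rw [integral_finsetSum _ fun B _ => hint B, ENNReal.toReal_inv, ENNReal.toReal_natCast,
    RCLike.real_smul_eq_coe_mul, RCLike.ofReal_inv, RCLike.ofReal_natCast]

theorem integral_conv {f g : List S → 𝕜} (hf_meas : Measurable f) (hg_meas : Measurable g)
    (hf : Integrable f (lebesguePoisson ρ)) (hg : Integrable g (lebesguePoisson ρ)) :
    ∫ l, conv f g l ∂lebesguePoisson ρ =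
      (∫ l, f l ∂lebesguePoisson ρ) * ∫ l, g l ∂lebesguePoisson ρ :=
  (integral_splitSum (by fun_prop) (hf.mul_prod hg)).trans (integral_prod_mul f g)

end IntegralConv

section ConvExp

variable {α : Type*}

/-- The powers of `f` with respect to the convolution. -/
def convPow {R : Type*} [Semiring R] (f : List α → R) (k : ℕ) : List α → R :=
  convProd (fun _ => f) (List.replicate k ())

theorem convPow_succ {R : Type*} [Semiring R] (f : List α → R) (k : ℕ) :
    convPow f (k + 1) = conv f (convPow f k) := rfl

theorem convPow_succ_cons {R : Type*} [CommSemiring R] (f : List α → R) (k : ℕ) (x : α)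
    (l : List α) :
    convPow f (k + 1) (x :: l) = (k + 1) * conv (fun a => f (x :: a)) (convPow f k) l := by
  induction k generalizing l with
  | zero =>
    have hzero : conv f (fun b => convPow f 0 (x :: b)) l = 0 := by
      simp only [conv, convPow, List.replicate_zero, convProd, convOne, mul_zero, splitSum_zero]
    rw [convPow_succ, conv_cons, hzero, Nat.cast_zero, zero_add, one_mul, add_zero]
  | succ k ih =>
    have hcomm : conv f (conv (fun a => f (x :: a)) (convPow f k)) l =
        conv (fun a => f (x :: a)) (convPow f (k + 1)) l := by
      rw [← conv_assoc, funext (conv_comm f _), conv_assoc, convPow_succ]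
    rw [convPow_succ, conv_cons, conv_comm f]
    simp only [ih, conv_const_mul_left]
    rw [conv_comm _ f, hcomm]
    push_cast
    ring

/-- `g` is the exponential of `f` with respect to the convolution. This is encoded by the
differential equation satisfied by an exponential, for the derivations `f ↦ f (x :: ·)`. -/
structure IsConvExp {R : Type*} [Semiring R] (f g : List α → R) : Prop where
  left_nil : f [] = 0
  right_nil : g [] = 1
  right_cons : ∀ x l, g (x :: l) = conv (fun a => f (x :: a)) g l

theorem hasSum_splitSum {ι R : Type*} [AddCommMonoid R] [TopologicalSpace R] [ContinuousAdd R]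
    {l : List α} {F : ι → List α → List α → R} {K : List α → List α → R}
    (h : ∀ a b, (a ++ b).Perm l → HasSum (fun i => F i a b) (K a b)) :
    HasSum (fun i => splitSum l (F i)) (splitSum l K) := by
  induction l generalizing F K with
  | nil => exact h [] [] (.refl _)
  | cons x l ih =>
    exact (ih fun a b hab => h _ _ (hab.cons x)).add
      (ih fun a b hab => h _ _ (List.perm_middle.trans (hab.cons x)))

variable {𝕜 : Type*} [RCLike 𝕜]

theorem IsConvExp.hasSum_convPow {f g : List α → 𝕜} (h : IsConvExp f g) (l : List α) :
    HasSum (fun k : ℕ => ((k ! : ℕ) : 𝕜)⁻¹ * convPow f k l) (g l) := by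
  induction hn : l.length using Nat.strong_induction_on generalizing l with
  | _ n ih =>
    obtain _ | ⟨x, l⟩ := l
    · rw [h.right_nil]
      refine (hasSum_ite_eq 0 (1 : 𝕜)).congr_fun fun k => ?_
      cases k <;> simp [convPow, List.replicate_succ, convProd, convOne, conv_nil, h.left_nil]
    · rw [← hasSum_nat_add_iff' 1, Finset.sum_range_one]
      simp only [convPow_succ_cons, h.right_cons x l]
      have hzero : convPow f 0 (x :: l) = 0 := rfl
      rw [hzero, mul_zero, sub_zero]
      refine (hasSum_splitSum fun a b hab => (ih b.length ?_ b rfl).mul_left (f (x :: a))).congr_fun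
        fun k => ?_
      · rw [← hn, List.length_cons, ← hab.length_eq, List.length_append]
        lia
      · rw [conv, ← splitSum_const_mul, ← splitSum_const_mul]
        refine splitSum_congr fun a b _ => ?_
        rw [Nat.factorial_succ]
        push_cast
        field_simp

theorem enorm_convPow_le (f : List α → 𝕜) (k : ℕ) (l : List α) :
    ‖convPow f k l‖ₑ ≤ convPow (fun a => ‖f a‖ₑ) k l := by
  induction k generalizing l with
  | zero => cases l <;> simp [convPow, convProd, convOne]
  | succ k ih => exact (enorm_conv_le _ _ _).trans (conv_mono (fun _ => le_rfl) ih _)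

section Integral

variable [MeasurableSpace α] {ρ : Measure α} [SigmaFinite ρ] {f g : List α → 𝕜}

theorem lintegral_enorm_convPow_le (hf_meas : Measurable f) (k : ℕ) :
    ∫⁻ l, ‖convPow f k l‖ₑ ∂lebesguePoisson ρ ≤ (∫⁻ l, ‖f l‖ₑ ∂lebesguePoisson ρ) ^ k := by
  refine (lintegral_mono (enorm_convPow_le f k)).trans_eq ?_
  unfold convPow
  rw [lintegral_convProd fun _ => hf_meas.enorm, List.map_replicate, List.prod_replicate]

theorem integrable_convPow (hf_meas : Measurable f) (hf : Integrable f (lebesguePoisson ρ))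
    (k : ℕ) : Integrable (convPow f k) (lebesguePoisson ρ) :=
  ⟨(measurable_convProd (fun _ => hf_meas) _).aestronglyMeasurable,
    (lintegral_enorm_convPow_le hf_meas k).trans_lt (ENNReal.pow_lt_top hf.hasFiniteIntegral)⟩

theorem integral_convPow (hf_meas : Measurable f) (hf : Integrable f (lebesguePoisson ρ)) (k : ℕ) :
    ∫ l, convPow f k l ∂lebesguePoisson ρ = (∫ l, f l ∂lebesguePoisson ρ) ^ k := by
  induction k with
  | zero =>
    refine (hasSum_integral_lebesguePoisson (integrable_convPow hf_meas hf 0)).unique ?_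
    rw [pow_zero]
    refine (hasSum_ite_eq 0 (1 : 𝕜)).congr_fun fun n => ?_
    cases n <;> simp [convPow, convProd, convOne, Measure.real]
  | succ k ih =>
    have hpow : Measurable (convPow f k) := measurable_convProd (fun _ => hf_meas) _
    rw [convPow_succ, integral_conv hf_meas hpow hf (integrable_convPow hf_meas hf k), ih,
      pow_succ']

theorem tsum_lintegral_convPow_ne_top (hf_meas : Measurable f)
    (hf : Integrable f (lebesguePoisson ρ)) :
    ∑' k : ℕ, ∫⁻ l, ‖((k ! : ℕ) : 𝕜)⁻¹ * convPow f k l‖ₑ ∂lebesguePoisson ρ ≠ ⊤ := by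
  obtain ⟨c, hc⟩ : ∃ c : NNReal, (c : ℝ≥0∞) = ∫⁻ l, ‖f l‖ₑ ∂lebesguePoisson ρ :=
    WithTop.ne_top_iff_exists.1 hf.hasFiniteIntegral.ne
  have hsum : Summable fun k : ℕ => ((k ! : ℕ) : NNReal)⁻¹ * c ^ k := by
    refine NNReal.summable_coe.1 ?_
    simpa [div_eq_inv_mul] using Real.summable_pow_div_factorial (c : ℝ)
  refine ne_top_of_le_ne_top (ENNReal.tsum_coe_ne_top_iff_summable.2 hsum)
    (ENNReal.tsum_le_tsum fun k => ?_)
  simp only [enorm_mul, enorm_inv_factorial]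
  rw [lintegral_const_mul' _ _ (by simp [Nat.factorial_ne_zero]), ENNReal.coe_mul,
    ENNReal.coe_inv (by exact_mod_cast k.factorial_ne_zero), ENNReal.coe_natCast, ENNReal.coe_pow,
    hc]
  gcongr
  exact lintegral_enorm_convPow_le hf_meas k

theorem IsConvExp.integrable (h : IsConvExp f g) (hf_meas : Measurable f) (hg_meas : Measurable g)
    (hf : Integrable f (lebesguePoisson ρ)) : Integrable g (lebesguePoisson ρ) := by
  refine ⟨hg_meas.aestronglyMeasurable, ?_⟩
  calc ∫⁻ l, ‖g l‖ₑ ∂lebesguePoisson ρ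
    _ ≤ ∫⁻ l, ∑' k : ℕ, ‖((k ! : ℕ) : 𝕜)⁻¹ * convPow f k l‖ₑ ∂lebesguePoisson ρ :=
      lintegral_mono fun l => by
        rw [← (h.hasSum_convPow l).tsum_eq]
        exact enorm_tsum_le_tsum_enorm
    _ = ∑' k : ℕ, ∫⁻ l, ‖((k ! : ℕ) : 𝕜)⁻¹ * convPow f k l‖ₑ ∂lebesguePoisson ρ :=
      lintegral_tsum fun k =>
        ((integrable_convPow hf_meas hf k).const_mul _).aestronglyMeasurable.enorm
    _ < ⊤ := (tsum_lintegral_convPow_ne_top hf_meas hf).lt_top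

theorem IsConvExp.integral_eq_exp (h : IsConvExp f g) (hf_meas : Measurable f)
    (hf : Integrable f (lebesguePoisson ρ)) :
    ∫ l, g l ∂lebesguePoisson ρ = NormedSpace.exp (∫ l, f l ∂lebesguePoisson ρ) := by
  simp only [← fun l => (h.hasSum_convPow l).tsum_eq]
  rw [integral_tsum (fun k => ((integrable_convPow hf_meas hf k).const_mul _).aestronglyMeasurable)
    (tsum_lintegral_convPow_ne_top hf_meas hf)]
  simp only [integral_const_mul, integral_convPow hf_meas hf]
  rw [← (NormedSpace.expSeries_div_hasSum_exp _).tsum_eq]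
  simp only [div_eq_inv_mul]

end Integral
end ConvExp

section Supersolution

variable {S : Type*} [MeasurableSpace S] {ρ : Measure S} [SigmaFinite ρ] {γ θ : S → List S → ℝ≥0∞}

theorem measurable_ite_length (hγ : Measurable fun q : S × List S => γ q.1 q.2) (n : ℕ) :
    Measurable fun q : S × List S => if q.2.length < n then γ q.1 q.2 else 0 := by
  have hlength : Measurable (List.length : List S → ℕ) :=
    measurable_list_iff.2 fun m => by simp
  exact hγ.ite ((hlength.comp measurable_snd) measurableSet_Iio) measurable_const

/-- On lists of length at most `n`, the right-hand side only involves values of `γ` on lists of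
length less than `n`. -/
theorem lintegral_ite_length_lt_succ_le (hγ : Measurable fun q : S × List S => γ q.1 q.2)
    (hθ : ∀ x, Measurable (θ x))
    (hγθ : ∀ x l, γ x l ≤ splitSum l fun N M => θ x N * convProd γ N M) (n : ℕ) (x : S) :
    ∫⁻ l, (if l.length < n + 1 then γ x l else 0) ∂lebesguePoisson ρ ≤
      ∫⁻ N, θ x N * (N.map fun a => ∫⁻ l, (if l.length < n then γ a l else 0)
        ∂lebesguePoisson ρ).prod ∂lebesguePoisson ρ := by
  set γ' : S → List S → ℝ≥0∞ := fun a l => if l.length < n then γ a l else 0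
  have hγ'_meas : Measurable fun q : S × List S => γ' q.1 q.2 :=
    measurable_ite_length hγ n
  have hle : ∀ l : List S, (if l.length < n + 1 then γ x l else 0) ≤
      splitSum l fun N M => θ x N * convProd γ' N M := fun l => by
    split_ifs with hl
    · refine (hγθ x l).trans (splitSum_mono fun N M hNM => le_of_eq ?_)
      obtain _ | ⟨a, N⟩ := N
      · rfl
      · have hlen := hNM.length_eq
        simp only [List.length_append, List.length_cons] at hlen
        refine congrArg _ (convProd_congr (fun b a ha => ?_) _)
        exact (if_pos (by lia)).symm
    · exact zero_le
  have hγ'_root : ∀ a, Measurable (γ' a) := fun a => hγ'_meas.comp measurable_prodMk_left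
  refine (lintegral_mono hle).trans_eq ?_
  rw [lintegral_splitSum ρ (((hθ x).comp measurable_fst).mul (measurable_convProd_prod hγ'_meas))]
  exact lintegral_congr fun N => by
    rw [lintegral_const_mul _ (measurable_convProd hγ'_root N), lintegral_convProd hγ'_root]

theorem lintegral_le_of_le_splitSum_convProd (hγ : Measurable fun q : S × List S => γ q.1 q.2)
    (hθ : ∀ x, Measurable (θ x))
    (hγθ : ∀ x l, γ x l ≤ splitSum l fun N M => θ x N * convProd γ N M) {μ : S → ℝ≥0∞}
    (hμ : ∀ x, ∫⁻ N, θ x N * (N.map μ).prod ∂lebesguePoisson ρ ≤ μ x) (x : S) :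
    ∫⁻ l, γ x l ∂lebesguePoisson ρ ≤ μ x := by
  have htrunc : ∀ n x, ∫⁻ l, (if l.length < n then γ x l else 0) ∂lebesguePoisson ρ ≤ μ x := by
    intro n
    induction n with
    | zero => simp
    | succ n ih =>
      intro x
      refine (lintegral_ite_length_lt_succ_le hγ hθ hγθ n x).trans (le_trans ?_ (hμ x))
      gcongr with N
      exact List.prod_le_prod' fun a _ => ih a
  have hsup : ∀ l, γ x l = ⨆ n, if l.length < n then γ x l else 0 := fun l =>
    le_antisymm (le_iSup_of_le (l.length + 1) (by simp)) (iSup_le fun n => by split_ifs <;> simp)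
  rw [lintegral_congr hsup, lintegral_iSup]
  · exact iSup_le fun n => htrunc n x
  · exact fun n => (measurable_ite_length hγ n).comp measurable_prodMk_left
  · intro m n hmn l
    dsimp only
    split_ifs <;> first | lia | simp

end Supersolution

section Pinned

variable {S : Type*} [MeasurableSpace S] {w : S → S → ℂ}

theorem measurable_apply_pair (hw : Measurable (Function.uncurry w)) {n : ℕ} (i j : Fin n) :
    Measurable fun y : Fin n → S => w (y i) (y j) :=
  hw.comp (g := Function.uncurry w) (f := fun y : Fin n → S => (y i, y j))
    ((measurable_pi_apply i).prodMk (measurable_pi_apply j))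

theorem measurable_listWeight (hw : Measurable (Function.uncurry w)) :
    Measurable (listWeight w) := by
  refine measurable_list_iff.2 fun n => ?_
  simp only [listWeight_ofFn]
  exact Finset.measurable_prod _ fun p _ => measurable_apply_pair hw p.1 p.2

theorem measurable_listTrunc (hw : Measurable (Function.uncurry w)) : Measurable (listTrunc w) := by
  refine measurable_list_iff.2 fun n => ?_
  simp only [listTrunc_ofFn, truncatedWeight]
  exact Finset.measurable_sum _ fun G _ => Finset.measurable_prod _ fun p _ =>
    (measurable_apply_pair hw p.1 p.2).sub_const 1

theorem vertexSum_eq_lintegral (w : S → S → ℂ) (ν : SigmaFiniteComplexMeasure S) (μ : S → ℝ≥0∞)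
    (x : S) :
    vertexSum w ν μ x = ∫⁻ N, (N.map fun y => ‖w x y - 1‖ₑ).prod * ‖listWeight w N‖ₑ *
      (N.map μ).prod ∂lebesguePoisson ν.variation := by
  rw [lintegral_lebesguePoisson]
  simp only [enorm_listWeight]
  simp only [listWeight_ofFn, prod_map_ofFn]
  rw [tsum_eq_zero_add' ENNReal.summable]
  simp [vertexSum, vertexWeight, SigmaFiniteComplexMeasure.variationPow]

theorem absPinned_eq_lintegral (w : S → S → ℂ) (ν : SigmaFiniteComplexMeasure S) (x : S) :
    absPinned w ν x = ∫⁻ l, ‖listTrunc w (x :: l)‖ₑ ∂lebesguePoisson ν.variation := by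
  rw [lintegral_lebesguePoisson]
  simp only [← List.ofFn_cons, listTrunc_ofFn]
  rfl

theorem lintegral_listTrunc_cons_le {ρ : Measure S} [SigmaFinite ρ]
    (hw_meas : Measurable (Function.uncurry w)) (hw_symm : ∀ x y, w x y = w y x)
    (hw : ∀ x y, ‖w x y‖ₑ ≤ 1) {μ : S → ℝ≥0∞}
    (hμ : ∀ x, ∫⁻ N, (N.map fun y => ‖w x y - 1‖ₑ).prod * ‖listWeight w N‖ₑ *
      (N.map μ).prod ∂lebesguePoisson ρ ≤ μ x) (x : S) :
    ∫⁻ l, ‖listTrunc w (x :: l)‖ₑ ∂lebesguePoisson ρ ≤ μ x := by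
  refine lintegral_le_of_le_splitSum_convProd (γ := fun x l => ‖listTrunc w (x :: l)‖ₑ)
    ((measurable_listTrunc hw_meas).comp measurable_cons).enorm (fun x => ?_)
    (enorm_le_splitSum_convProd hw_symm hw (conv_listTrunc hw_symm)) hμ x
  have hbond : Measurable fun y => ‖w x y - 1‖ₑ := (hw_meas.of_uncurry_left.sub_const 1).enorm
  exact (measurable_prod_map hbond).mul (measurable_listWeight hw_meas).enorm

end Pinned

section PinnedSeries

variable {S : Type*} [MeasurableSpace S] {w : S → S → ℂ}

/-- The density `∏ i, z θ(xᵢ)` of the powers of the complex measure `zν` with respect to the powers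
of its total variation `|ν|`. -/
def activity (ν : SigmaFiniteComplexMeasure S) (z : ℂ) (l : List S) : ℂ :=
  (l.map fun x => z * ν.phase x).prod

theorem activity_ofFn (ν : SigmaFiniteComplexMeasure S) (z : ℂ) {n : ℕ} (y : Fin n → S) :
    activity ν z (List.ofFn y) = z ^ n * ν.phasePow y := by
  rw [activity, prod_map_ofFn, Finset.prod_mul_distrib, Finset.prod_const, Finset.card_fin]
  rfl

theorem measurable_activity (ν : SigmaFiniteComplexMeasure S) (z : ℂ) : Measurable (activity ν z) :=
  measurable_prod_map (ν.measurable_phase.const_mul z)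

theorem norm_activity (ν : SigmaFiniteComplexMeasure S) (z : ℂ) (l : List S) :
    ‖activity ν z l‖ = ‖z‖ ^ l.length := by
  induction l with
  | nil => simp [activity]
  | cons x l ih => rw [activity, List.map_cons, List.prod_cons, norm_mul, norm_mul, ν.norm_phase,
      mul_one, ← activity, ih, List.length_cons, pow_succ']

theorem enorm_activity_one (ν : SigmaFiniteComplexMeasure S) (l : List S) :
    ‖activity ν 1 l‖ₑ = 1 := by
  rw [← ofReal_norm, norm_activity, norm_one, one_pow, ENNReal.ofReal_one]

theorem pinnedIntegrand_eq (w : S → S → ℂ) (ν : SigmaFiniteComplexMeasure S) (x : S) (n : ℕ) :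
    pinnedIntegrand w ν x n = fun y =>
      listTrunc w (x :: List.ofFn y) * activity ν 1 (List.ofFn y) := by
  funext y
  rw [← List.ofFn_cons, listTrunc_ofFn, activity_ofFn, one_pow, one_mul]
  rfl

theorem tsum_enorm_pinnedTerm_le (w : S → S → ℂ) (ν : SigmaFiniteComplexMeasure S) (x : S) :
    ∑' n, ‖pinnedTerm w ν x n‖ₑ ≤ absPinned w ν x := by
  simp only [pinnedTerm, pinnedIntegrand_eq]
  refine (tsum_enorm_integral_le ν.variation fun l =>
    listTrunc w (x :: l) * activity ν 1 l).trans_eq ?_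
  simp [enorm_mul, enorm_activity_one, absPinned_eq_lintegral]

theorem enorm_pinned_le_absPinned (w : S → S → ℂ) (ν : SigmaFiniteComplexMeasure S) (x : S) :
    ‖pinned w ν x‖ₑ ≤ absPinned w ν x :=
  enorm_tsum_le_tsum_enorm.trans (tsum_enorm_pinnedTerm_le w ν x)

theorem summable_norm_pinnedTerm {ν : SigmaFiniteComplexMeasure S} {x : S}
    (h : absPinned w ν x < ⊤) : Summable fun n => ‖pinnedTerm w ν x n‖ :=
  tsum_enorm_ne_top_iff_summable_norm.1 (ne_top_of_le_ne_top h.ne (tsum_enorm_pinnedTerm_le w ν x))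

theorem integrable_pinnedIntegrand {ν : SigmaFiniteComplexMeasure S}
    (hw_meas : Measurable (Function.uncurry w)) {x : S} (h : absPinned w ν x < ⊤) (n : ℕ) :
    Integrable (pinnedIntegrand w ν x n) (ν.variationPow n) := by
  have hmeas : Measurable fun l => listTrunc w (x :: l) * activity ν 1 l :=
    ((measurable_listTrunc hw_meas).comp (measurable_cons.comp measurable_prodMk_left)).mul
      (measurable_activity ν 1)
  rw [pinnedIntegrand_eq]
  refine integrable_comp_ofFn (f := fun l => listTrunc w (x :: l) * activity ν 1 l)
    ⟨hmeas.aestronglyMeasurable, ?_⟩ n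
  simpa [HasFiniteIntegral, enorm_mul, enorm_activity_one, ← absPinned_eq_lintegral] using h

theorem absPinned_le {ν : SigmaFiniteComplexMeasure S}
    (hw_meas : Measurable (Function.uncurry w)) (hw_symm : ∀ x y, w x y = w y x)
    (hw : ∀ x y, ‖w x y‖ₑ ≤ 1) {μ : S → ℝ≥0∞} (hμ : ∀ x, vertexSum w ν μ x ≤ μ x) (x : S) :
    absPinned w ν x ≤ μ x := by
  simp only [vertexSum_eq_lintegral] at hμ
  rw [absPinned_eq_lintegral]
  exact lintegral_listTrunc_cons_le hw_meas hw_symm hw hμ x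

end PinnedSeries

section Mecke

variable {S : Type*}

/-- The function `K a b` on splittings that is `f x b` if `a` consists of the single point `x`, and
vanishes otherwise. -/
def rooted {R : Type*} [Zero R] (f : S → List S → R) : List S → List S → R
  | [x], b => f x b
  | _, _ => 0

theorem le_splitSum_rooted {f : List S → ℝ≥0∞} (hf : ∀ l l', l.Perm l' → f l = f l') {A : Set S}
    {l : List S} (hl : ∃ x ∈ l, x ∈ A) :
    f l ≤ splitSum l (rooted fun x b => A.indicator (fun x => f (x :: b)) x) := by
  induction l generalizing f with
  | nil => simp at hl
  | cons y l ih =>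
    by_cases hy : y ∈ A
    · refine le_add_right (le_trans (le_of_eq ?_) (apply_nil_le_splitSum _ l))
      rw [rooted, Set.indicator_of_mem hy]
    · obtain ⟨x, hx, hxA⟩ := hl
      have hxl : x ∈ l := (List.mem_cons.1 hx).resolve_left fun h => hy (h ▸ hxA)
      refine (ih (f := fun l => f (y :: l)) (fun l l' h => hf _ _ (h.cons y)) ⟨x, hxl, hxA⟩).trans
        (le_trans (le_of_eq ?_) le_add_self)
      refine splitSum_congr fun a b _ => ?_
      rcases a with _ | ⟨z, _ | ⟨z', a⟩⟩
      · rfl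
      · simp only [rooted, Set.indicator, hf _ _ (List.Perm.swap y z b)]
      · rfl

variable [MeasurableSpace S] {ρ : Measure S}

theorem measurable_rooted {f : S → List S → ℝ≥0∞}
    (hf : Measurable fun q : S × List S => f q.1 q.2) :
    Measurable fun q : List S × List S => rooted f q.1 q.2 := by
  suffices h : ∀ n, Measurable fun q : List S × (Fin n → S) => rooted f (List.ofFn q.2) q.1 from
    (measurable_prod_list_iff (f := fun q : List S × List S => rooted f q.2 q.1).2 h).comp
      measurable_swap
  rintro (_ | _ | n)
  · simp [rooted]
  · exact hf.comp (f := fun q : List S × (Fin 1 → S) => (q.2 0, q.1)) (by fun_prop)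
  · simp [rooted]

/-- Mecke's formula. -/
theorem lintegral_splitSum_rooted [SigmaFinite ρ] {f : S → List S → ℝ≥0∞}
    (hf : Measurable fun q : S × List S => f q.1 q.2) :
    ∫⁻ l, splitSum l (rooted f) ∂lebesguePoisson ρ =
      ∫⁻ x, ∫⁻ l, f x l ∂lebesguePoisson ρ ∂ρ := by
  have hzero : ∀ n ≠ 1, ((n ! : ℕ) : ℝ≥0∞)⁻¹ * ∫⁻ y : Fin n → S,
      ∫⁻ b, rooted f (List.ofFn y) b ∂lebesguePoisson ρ ∂Measure.pi (fun _ => ρ) = 0 := by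
    rintro (_ | _ | n) hn
    · simp [rooted]
    · exact absurd rfl hn
    · simp [rooted]
  rw [lintegral_splitSum ρ (measurable_rooted hf), lintegral_lebesguePoisson,
    tsum_eq_single 1 hzero]
  simp only [Nat.factorial_one, Nat.cast_one, inv_one, one_mul]
  exact (measurePreserving_funUnique ρ (Fin 1)).lintegral_comp_emb
    (MeasurableEquiv.measurableEmbedding _) fun x => ∫⁻ b, f x b ∂lebesguePoisson ρ

theorem setLIntegral_exists_mem_le [SigmaFinite ρ] {f : List S → ℝ≥0∞} (hf_meas : Measurable f)
    (hf : ∀ l l', l.Perm l' → f l = f l') {A : Set S} (hA : MeasurableSet A) :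
    ∫⁻ l in {l | ∃ x ∈ l, x ∈ A}, f l ∂lebesguePoisson ρ ≤
      ∫⁻ x in A, ∫⁻ l, f (x :: l) ∂lebesguePoisson ρ ∂ρ := by
  have hmeas : Measurable fun q : S × List S => A.indicator (fun x => f (x :: q.2)) q.1 :=
    (hf_meas.comp measurable_cons).indicator (measurable_fst hA)
  refine (setLIntegral_mono (measurable_splitSum (measurable_rooted hmeas))
    fun l hl => le_splitSum_rooted hf hl).trans ((setLIntegral_le_lintegral _ _).trans_eq ?_)
  rw [lintegral_splitSum_rooted hmeas, ← lintegral_indicator hA]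
  refine lintegral_congr fun x => ?_
  by_cases hx : x ∈ A <;> simp [hx]

theorem lintegral_lebesguePoisson_le_setLIntegral_add [SigmaFinite ρ] {f : List S → ℝ≥0∞}
    (hf_meas : Measurable f) (hf : ∀ l l', l.Perm l' → f l = f l') {A : Set S}
    (hA : MeasurableSet A) :
    ∫⁻ l, f l ∂lebesguePoisson ρ ≤
      ∫⁻ x in A, ∫⁻ l, f (x :: l) ∂lebesguePoisson ρ ∂ρ +
        ∫⁻ l, f l ∂lebesguePoisson (ρ.restrict Aᶜ) := by
  rw [lebesguePoisson_restrict, ← setLIntegral_univ]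
  refine (lintegral_mono_set (fun l _ => ?_)).trans ((lintegral_union_le _
    {l | ∃ x ∈ l, x ∈ A} {l | ∀ x ∈ l, x ∈ Aᶜ}).trans
      (add_le_add_left (setLIntegral_exists_mem_le hf_meas hf hA) _))
  by_cases h : ∃ x ∈ l, x ∈ A
  · exact .inl h
  · exact .inr fun x hx hxA => h ⟨x, hx, hxA⟩

theorem lintegral_lebesguePoisson_le [SigmaFinite ρ] {f : List S → ℝ≥0∞}
    (hf_meas : Measurable f) (hf : ∀ l l', l.Perm l' → f l = f l') (hnil : f [] = 0) :
    ∫⁻ l, f l ∂lebesguePoisson ρ ≤ ∫⁻ x, ∫⁻ l, f (x :: l) ∂lebesguePoisson ρ ∂ρ := by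
  have hzero : ∫⁻ l, f l ∂lebesguePoisson (0 : Measure S) = 0 := by
    rw [lintegral_lebesguePoisson, ENNReal.tsum_eq_zero]
    rintro (_ | n)
    · simp [hnil]
    · have hpi : (Measure.pi fun _ : Fin (n + 1) => (0 : Measure S)) = 0 :=
        Measure.measure_univ_eq_zero.1 (by simp [Measure.pi_univ])
      rw [hpi, lintegral_zero_measure, mul_zero]
  simpa [hzero] using lintegral_lebesguePoisson_le_setLIntegral_add (ρ := ρ) hf_meas hf .univ

end Mecke

section AbsCluster

variable {S : Type*} [MeasurableSpace S] {w : S → S → ℂ} {ρ : Measure S} [SigmaFinite ρ]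

theorem absCluster_eq_lintegral (w : S → S → ℂ) (ν : SigmaFiniteComplexMeasure S) (Λ : Set S) :
    absCluster w ν Λ = ∫⁻ l, ‖listTrunc w l‖ₑ ∂lebesguePoisson (ν.variation.restrict Λ) := by
  rw [lintegral_lebesguePoisson, tsum_eq_zero_add' ENNReal.summable]
  simp only [listTrunc_ofFn, ← Measure.restrict_pi_pi]
  simp [absCluster, cube, SigmaFiniteComplexMeasure.variationPow, ← listTrunc_ofFn, listTrunc_nil]

theorem lintegral_listTrunc_le (hw_meas : Measurable (Function.uncurry w))
    (hw_symm : ∀ x y, w x y = w y x) :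
    ∫⁻ l, ‖listTrunc w l‖ₑ ∂lebesguePoisson ρ ≤
      ∫⁻ x, ∫⁻ l, ‖listTrunc w (x :: l)‖ₑ ∂lebesguePoisson ρ ∂ρ :=
  lintegral_lebesguePoisson_le (measurable_listTrunc hw_meas).enorm
    (fun _ _ h => congrArg _ (listTrunc_perm hw_symm h)) (by simp [listTrunc_nil])

theorem lintegral_listTrunc_cons_restrict_le (w : S → S → ℂ) (Λ : Set S) (x : S) :
    ∫⁻ l, ‖listTrunc w (x :: l)‖ₑ ∂lebesguePoisson (ρ.restrict Λ) ≤
      ∫⁻ l, ‖listTrunc w (x :: l)‖ₑ ∂lebesguePoisson ρ := by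
  rw [lebesguePoisson_restrict]
  exact setLIntegral_le_lintegral _ _

theorem absCluster_le_setLIntegral_absPinned (hw_meas : Measurable (Function.uncurry w))
    (hw_symm : ∀ x y, w x y = w y x) (ν : SigmaFiniteComplexMeasure S) (Λ : Set S) :
    absCluster w ν Λ ≤ ∫⁻ x in Λ, absPinned w ν x ∂ν.variation := by
  simp only [absCluster_eq_lintegral, absPinned_eq_lintegral]
  refine (lintegral_listTrunc_le hw_meas hw_symm).trans (lintegral_mono fun x => ?_)
  exact lintegral_listTrunc_cons_restrict_le w Λ x

theorem lintegral_pow_length_le_two (c : ℝ≥0∞) (h : c * ρ Set.univ ≤ 2⁻¹) :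
    ∫⁻ l, c ^ l.length ∂lebesguePoisson ρ ≤ 2 := by
  calc ∫⁻ l, c ^ l.length ∂lebesguePoisson ρ
    _ = ∑' n : ℕ, ((n ! : ℕ) : ℝ≥0∞)⁻¹ * (c * ρ Set.univ) ^ n := by
      rw [lintegral_lebesguePoisson]
      refine tsum_congr fun n => ?_
      simp [Measure.pi_univ, mul_pow]
    _ ≤ ∑' n : ℕ, 2⁻¹ ^ n := ENNReal.tsum_le_tsum fun n => by
      refine mul_le_of_le_one_of_le ?_ (by gcongr)
      exact ENNReal.inv_le_one.2 (by exact_mod_cast n.factorial_pos)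
    _ = 2 := by rw [ENNReal.tsum_geometric, ENNReal.one_sub_inv_two, inv_inv]

theorem enorm_sub_one_le_two {z : ℂ} (hz : ‖z‖ₑ ≤ 1) : ‖z - 1‖ₑ ≤ 2 := by
  rw [← one_add_one_eq_two]
  exact enorm_sub_le.trans (add_le_add hz enorm_one.le)

theorem lintegral_bonds_two_le (hw : ∀ x y, ‖w x y‖ₑ ≤ 1) (hρ : ρ Set.univ ≤ 8⁻¹) (x : S) :
    ∫⁻ N, (N.map fun y => ‖w x y - 1‖ₑ).prod * ‖listWeight w N‖ₑ * (N.map fun _ => 2).prod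
      ∂lebesguePoisson ρ ≤ 2 := by
  have hfour : (4 : ℝ≥0∞) * ρ Set.univ ≤ 2⁻¹ := by
    refine (mul_le_mul_right hρ 4).trans_eq (ENNReal.eq_inv_of_mul_eq_one_left ?_)
    rw [mul_right_comm, ← ENNReal.mul_inv_cancel (a := 8) (by simp) (by simp)]
    norm_num
  refine (lintegral_mono fun N => ?_).trans (lintegral_pow_length_le_two 4 hfour)
  have hbonds : (N.map fun y => ‖w x y - 1‖ₑ).prod ≤ 2 ^ N.length := by
    refine (List.prod_le_pow_card _ 2 fun c hc => ?_).trans_eq (by rw [List.length_map])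
    obtain ⟨y, -, rfl⟩ := List.mem_map.1 hc
    exact enorm_sub_one_le_two (hw x y)
  calc (N.map fun y => ‖w x y - 1‖ₑ).prod * ‖listWeight w N‖ₑ * (N.map fun _ => 2).prod
    _ ≤ 2 ^ N.length * 1 * 2 ^ N.length := by
      gcongr
      · exact enorm_listWeight_le_one hw N
      · simp
    _ = 4 ^ N.length := by
      rw [mul_one, ← mul_pow]
      norm_num

theorem lintegral_listTrunc_lt_top_of_small (hw_meas : Measurable (Function.uncurry w))
    (hw_symm : ∀ x y, w x y = w y x) (hw : ∀ x y, ‖w x y‖ₑ ≤ 1) (hρ : ρ Set.univ ≤ 8⁻¹) :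
    ∫⁻ l, ‖listTrunc w l‖ₑ ∂lebesguePoisson ρ < ⊤ := by
  have hpinned := lintegral_listTrunc_cons_le (μ := fun _ => 2) hw_meas hw_symm hw
    (lintegral_bonds_two_le hw hρ)
  calc ∫⁻ l, ‖listTrunc w l‖ₑ ∂lebesguePoisson ρ
    _ ≤ ∫⁻ _, 2 ∂ρ := (lintegral_listTrunc_le hw_meas hw_symm).trans (lintegral_mono hpinned)
    _ = 2 * ρ Set.univ := lintegral_const _
    _ < ⊤ := ENNReal.mul_lt_top (by simp) (hρ.trans_lt (by simp))

theorem exists_measure_lt_le {ρ : Measure S} [IsFiniteMeasure ρ] {g : S → ℝ≥0∞} (hg : Measurable g)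
    (hfin : ∀ᵐ x ∂ρ, g x < ⊤) {ε : ℝ≥0∞} (hε : 0 < ε) : ∃ R : ℕ, ρ {x | (R : ℝ≥0∞) < g x} ≤ ε := by
  have hanti : Antitone fun R : ℕ => {x | (R : ℝ≥0∞) < g x} := fun R R' h x hx =>
    (Nat.cast_le.2 h).trans_lt (show (R' : ℝ≥0∞) < g x from hx)
  have hinter : ρ (⋂ R : ℕ, {x | (R : ℝ≥0∞) < g x}) = 0 := by
    refine measure_mono_null (fun x hx => ?_) (ae_iff.1 hfin)
    change ¬ g x < ⊤
    intro hgx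
    obtain ⟨R, hR⟩ := ENNReal.exists_nat_gt hgx.ne
    exact lt_asymm hR (Set.mem_iInter.1 hx R)
  have hlim := tendsto_measure_iInter_atTop (μ := ρ)
    (fun R => (measurableSet_lt measurable_const hg).nullMeasurableSet) hanti
    ⟨0, measure_ne_top _ _⟩
  rw [hinter] at hlim
  exact (hlim.eventually_le_const hε).exists

theorem lintegral_listTrunc_lt_top [IsFiniteMeasure ρ] (hw_meas : Measurable (Function.uncurry w))
    (hw_symm : ∀ x y, w x y = w y x) (hw : ∀ x y, ‖w x y‖ₑ ≤ 1)
    (hfin : ∀ᵐ x ∂ρ, ∫⁻ l, ‖listTrunc w (x :: l)‖ₑ ∂lebesguePoisson ρ < ⊤) :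
    ∫⁻ l, ‖listTrunc w l‖ₑ ∂lebesguePoisson ρ < ⊤ := by
  set G : S → ℝ≥0∞ := fun x => ∫⁻ l, ‖listTrunc w (x :: l)‖ₑ ∂lebesguePoisson ρ
  have hG : Measurable G :=
    ((measurable_listTrunc hw_meas).comp measurable_cons).enorm.lintegral_prod_right'
  obtain ⟨R, hR⟩ := exists_measure_lt_le hG hfin (ε := 8⁻¹) (by simp)
  have hA : MeasurableSet {x | G x ≤ R} := measurableSet_le hG measurable_const
  have hcompl : {x | G x ≤ R}ᶜ = {x | (R : ℝ≥0∞) < G x} := by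
    ext x
    simp
  refine (lintegral_lebesguePoisson_le_setLIntegral_add (measurable_listTrunc hw_meas).enorm
    (fun _ _ h => congrArg _ (listTrunc_perm hw_symm h)) hA).trans_lt
    (ENNReal.add_lt_top.2 ⟨?_, ?_⟩)
  · calc ∫⁻ x in {x | G x ≤ R}, G x ∂ρ
      _ ≤ ∫⁻ _ in {x | G x ≤ R}, (R : ℝ≥0∞) ∂ρ := setLIntegral_mono measurable_const fun x hx => hx
      _ = R * ρ {x | G x ≤ R} := setLIntegral_const _ _
      _ < ⊤ := ENNReal.mul_lt_top (ENNReal.natCast_lt_top R) (measure_lt_top _ _)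
  · refine lintegral_listTrunc_lt_top_of_small hw_meas hw_symm hw ?_
    rwa [hcompl, Measure.restrict_apply_univ]

theorem absCluster_lt_top (hw_meas : Measurable (Function.uncurry w))
    (hw_symm : ∀ x y, w x y = w y x) (hw : ∀ x y, ‖w x y‖ₑ ≤ 1)
    {ν : SigmaFiniteComplexMeasure S} {Λ : Set S} (hΛ : ν.variation Λ < ⊤)
    (hfin : ∀ᵐ x ∂ν.variation.restrict Λ, absPinned w ν x < ⊤) : absCluster w ν Λ < ⊤ := by
  have : IsFiniteMeasure (ν.variation.restrict Λ) := ⟨by simpa using hΛ⟩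
  rw [absCluster_eq_lintegral]
  refine lintegral_listTrunc_lt_top hw_meas hw_symm hw (hfin.mono fun x hx => ?_)
  rw [absPinned_eq_lintegral] at hx
  exact (lintegral_listTrunc_cons_restrict_le w Λ x).trans_lt hx

end AbsCluster

section LogPartitionFunction

variable {S : Type*} [MeasurableSpace S] {w : S → S → ℂ} {ν : SigmaFiniteComplexMeasure S}
  {Λ : Set S}

theorem isConvExp_listTrunc_mul_activity (hw_symm : ∀ x y, w x y = w y x)
    (ν : SigmaFiniteComplexMeasure S) (z : ℂ) :
    IsConvExp (fun l => listTrunc w l * activity ν z l)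
      (fun l => listWeight w l * activity ν z l) where
  left_nil := by rw [listTrunc_nil, zero_mul]
  right_nil := by simp [listWeight, activity]
  right_cons x l := by
    have hroot : (fun a => listTrunc w (x :: a) * activity ν z (x :: a)) = fun a =>
        z * ν.phase x * (activity ν z a * listTrunc w (x :: a)) := funext fun a => by
      simp only [activity, List.map_cons, List.prod_cons]
      ring
    have hactivity := conv_prod_map_mul (fun y => z * ν.phase y) (fun a => listTrunc w (x :: a))
      (listWeight w) l
    simp only [hroot, conv_const_mul_left, mul_comm (listWeight w _)]
    rw [conv_listTrunc hw_symm] at hactivity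
    simp only [activity, hactivity, List.map_cons, List.prod_cons, mul_assoc]

theorem clusterTerm_eq (w : S → S → ℂ) (ν : SigmaFiniteComplexMeasure S) (Λ : Set S) (n : ℕ) :
    clusterTerm w ν Λ n = ((n ! : ℕ) : ℂ)⁻¹ * ∫ y : Fin n → S,
      listTrunc w (List.ofFn y) * activity ν 1 (List.ofFn y)
        ∂Measure.pi fun _ => ν.variation.restrict Λ := by
  simp only [listTrunc_ofFn, activity_ofFn, one_pow, one_mul, ← Measure.restrict_pi_pi]
  rfl

theorem clusterTerm_zero (w : S → S → ℂ) (ν : SigmaFiniteComplexMeasure S) (Λ : Set S) :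
    clusterTerm w ν Λ 0 = 0 := by
  simp [clusterTerm_eq, listTrunc_nil]

theorem tsum_enorm_clusterTerm_le (w : S → S → ℂ) (ν : SigmaFiniteComplexMeasure S) (Λ : Set S) :
    ∑' n, ‖clusterTerm w ν Λ (n + 1)‖ₑ ≤ absCluster w ν Λ := by
  calc ∑' n, ‖clusterTerm w ν Λ (n + 1)‖ₑ
    _ = ∑' n, ‖clusterTerm w ν Λ n‖ₑ := by
      rw [eq_comm, tsum_eq_zero_add' ENNReal.summable, clusterTerm_zero, enorm_zero, zero_add]
    _ ≤ ∫⁻ l, ‖listTrunc w l * activity ν 1 l‖ₑ ∂lebesguePoisson (ν.variation.restrict Λ) := by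
      simp only [clusterTerm_eq]
      exact tsum_enorm_integral_le _ fun l => listTrunc w l * activity ν 1 l
    _ = absCluster w ν Λ := by simp [enorm_mul, enorm_activity_one, absCluster_eq_lintegral]

theorem summable_norm_clusterTerm (h : absCluster w ν Λ < ⊤) :
    Summable fun n => ‖clusterTerm w ν Λ (n + 1)‖ :=
  tsum_enorm_ne_top_iff_summable_norm.1 (ne_top_of_le_ne_top h.ne (tsum_enorm_clusterTerm_le w ν Λ))

theorem measurable_listTrunc_mul_activity (hw_meas : Measurable (Function.uncurry w))
    (ν : SigmaFiniteComplexMeasure S) (z : ℂ) :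
    Measurable fun l => listTrunc w l * activity ν z l :=
  (measurable_listTrunc hw_meas).mul (measurable_activity ν z)

theorem norm_listTrunc_mul_activity_le (w : S → S → ℂ) (ν : SigmaFiniteComplexMeasure S) {z : ℂ}
    (hz : z ∈ Metric.closedBall (0 : ℂ) 1) (l : List S) :
    ‖listTrunc w l * activity ν z l‖ ≤ ‖listTrunc w l‖ := by
  rw [norm_mul, norm_activity]
  exact mul_le_of_le_one_right (norm_nonneg _)
    (pow_le_one₀ (norm_nonneg z) (mem_closedBall_zero_iff.1 hz))

theorem integrable_listTrunc (hw_meas : Measurable (Function.uncurry w))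
    (h : absCluster w ν Λ < ⊤) :
    Integrable (listTrunc w) (lebesguePoisson (ν.variation.restrict Λ)) :=
  ⟨(measurable_listTrunc hw_meas).aestronglyMeasurable, by
    rwa [HasFiniteIntegral, ← absCluster_eq_lintegral]⟩

theorem integrable_listTrunc_mul_activity (hw_meas : Measurable (Function.uncurry w))
    (h : absCluster w ν Λ < ⊤) {z : ℂ} (hz : z ∈ Metric.closedBall (0 : ℂ) 1) :
    Integrable (fun l => listTrunc w l * activity ν z l)
      (lebesguePoisson (ν.variation.restrict Λ)) :=
  (integrable_listTrunc hw_meas h).mono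
    (measurable_listTrunc_mul_activity hw_meas ν z).aestronglyMeasurable
    (.of_forall (norm_listTrunc_mul_activity_le w ν hz))

theorem integrableOn_clusterIntegrand (hw_meas : Measurable (Function.uncurry w))
    (h : absCluster w ν Λ < ⊤) (n : ℕ) :
    IntegrableOn (clusterIntegrand w ν n) (cube Λ n) (ν.variationPow n) := by
  have hint := integrable_comp_ofFn
    (integrable_listTrunc_mul_activity hw_meas h (z := 1) (by simp)) n
  simp only [listTrunc_ofFn, activity_ofFn, one_pow, one_mul, ← Measure.restrict_pi_pi] at hint
  exact hint

/-- The sum `∑ₙ (zⁿ/n!) ∫_{Λⁿ} ω^T_n(x) ν(dx₁) ⋯ ν(dxₙ)` of the cluster expansion of `ln Ξ_Λ(zν)`,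
as an integral with respect to the Lebesgue–Poisson measure. -/
def clusterSum (w : S → S → ℂ) (ν : SigmaFiniteComplexMeasure S) (Λ : Set S) (z : ℂ) : ℂ :=
  ∫ l, listTrunc w l * activity ν z l ∂lebesguePoisson (ν.variation.restrict Λ)

theorem hasSum_clusterTerm (hw_meas : Measurable (Function.uncurry w))
    (h : absCluster w ν Λ < ⊤) :
    HasSum (fun n => clusterTerm w ν Λ (n + 1)) (clusterSum w ν Λ 1) := by
  have hsum := hasSum_integral_lebesguePoisson
    (integrable_listTrunc_mul_activity hw_meas h (z := 1) (by simp))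
  simp only [← clusterTerm_eq] at hsum
  rw [← hasSum_nat_add_iff' 1, Finset.sum_range_one, clusterTerm_zero, sub_zero] at hsum
  exact hsum

theorem enorm_clusterSum_one_le (w : S → S → ℂ) (ν : SigmaFiniteComplexMeasure S) (Λ : Set S) :
    ‖clusterSum w ν Λ 1‖ₑ ≤ absCluster w ν Λ := by
  refine (enorm_integral_le_lintegral_enorm _).trans_eq ?_
  simp [enorm_mul, enorm_activity_one, absCluster_eq_lintegral]

theorem continuousOn_clusterSum (hw_meas : Measurable (Function.uncurry w))
    (h : absCluster w ν Λ < ⊤) : ContinuousOn (clusterSum w ν Λ) (Metric.closedBall 0 1) := by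
  refine continuousOn_of_dominated
    (fun z _ => (measurable_listTrunc_mul_activity hw_meas ν z).aestronglyMeasurable)
    (fun z hz => .of_forall (norm_listTrunc_mul_activity_le w ν hz))
    (integrable_listTrunc hw_meas h).norm (.of_forall fun l => ?_)
  exact (continuous_const.mul (continuous_list_prod l fun x _ =>
    continuous_id.mul continuous_const)).continuousOn

theorem clusterSum_zero (w : S → S → ℂ) (ν : SigmaFiniteComplexMeasure S) (Λ : Set S) :
    clusterSum w ν Λ 0 = 0 := by
  have hzero : ∀ l, listTrunc w l * activity ν 0 l = 0 := fun l => by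
    cases l <;> simp [listTrunc_nil, activity]
  simp only [clusterSum, hzero, integral_zero]

theorem integral_listWeight_mul_activity {z : ℂ} (h : Integrable
    (fun l => listWeight w l * activity ν z l) (lebesguePoisson (ν.variation.restrict Λ))) :
    ∫ l, listWeight w l * activity ν z l ∂lebesguePoisson (ν.variation.restrict Λ) =
      partitionFunction w ν Λ z := by
  have hsum := hasSum_integral_lebesguePoisson h
  rw [← hsum.tsum_eq, hsum.summable.tsum_eq_zero_add]
  simp only [listWeight_ofFn, activity_ofFn, ← Measure.restrict_pi_pi]
  simp only [mul_left_comm, integral_const_mul]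
  refine congrArg₂ (· + ·) ?_ (tsum_congr fun n => ?_)
  · simp [SigmaFiniteComplexMeasure.phasePow, Measure.real]
  · rw [div_eq_mul_inv, mul_assoc]
    rfl

theorem exp_clusterSum (hw_meas : Measurable (Function.uncurry w))
    (hw_symm : ∀ x y, w x y = w y x) (h : absCluster w ν Λ < ⊤) {z : ℂ}
    (hz : z ∈ Metric.closedBall (0 : ℂ) 1) :
    Complex.exp (clusterSum w ν Λ z) = partitionFunction w ν Λ z := by
  have hexp := isConvExp_listTrunc_mul_activity hw_symm ν z
  have hmeas := measurable_listTrunc_mul_activity hw_meas ν z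
  have hint := integrable_listTrunc_mul_activity hw_meas h hz
  have hweight := (measurable_listWeight hw_meas).mul (measurable_activity ν z)
  rw [← integral_listWeight_mul_activity (hexp.integrable hmeas hweight hint),
    hexp.integral_eq_exp hmeas hint, Complex.exp_eq_exp_ℂ, clusterSum]

theorem isLogPartitionFunction_clusterSum (hw_meas : Measurable (Function.uncurry w))
    (hw_symm : ∀ x y, w x y = w y x) (h : absCluster w ν Λ < ⊤) :
    IsLogPartitionFunction w ν Λ (clusterSum w ν Λ 1) :=
  ⟨clusterSum w ν Λ, continuousOn_clusterSum hw_meas h, clusterSum_zero w ν Λ,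
    fun _ hz => exp_clusterSum hw_meas hw_symm h hz, rfl⟩

end LogPartitionFunction

end PinnedCluster

end

open MeasureTheory PinnedCluster in
theorem mainTheorem3 {S : Type*} [MeasurableSpace S]
    (ν : SigmaFiniteComplexMeasure S)
    (w : S → S → ℂ)
    (hw_meas : Measurable (Function.uncurry w))
    (hw_symm : ∀ x y, w x y = w y x)
    (hw_norm : ∀ x y, ‖w x y‖ ≤ 1)
    (μ : S → ENNReal)
    (hμ : ∀ x, vertexSum w ν μ x ≤ μ x) :
    -- (i) the pinned expansion
    (∀ x, ‖pinned w ν x‖ₑ ≤ absPinned w ν x ∧ absPinned w ν x ≤ μ x) ∧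
    (∀ x, μ x < ⊤ →
      (∀ n, Integrable (pinnedIntegrand w ν x n) (ν.variationPow n)) ∧
      Summable fun n => ‖pinnedTerm w ν x n‖) ∧
    -- (ii) the cluster expansions
    (∀ Λ : Set S, MeasurableSet Λ → ν.variation Λ < ⊤ →
      absCluster w ν Λ ≤ ∫⁻ x in Λ, μ x ∂ν.variation ∧
      ((∀ᵐ x ∂ν.variation.restrict Λ, μ x < ⊤) →
        absCluster w ν Λ < ⊤ ∧
        (∀ n, IntegrableOn (clusterIntegrand w ν (n + 1)) (cube Λ (n + 1))
          (ν.variationPow (n + 1))) ∧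
        (Summable fun n => ‖clusterTerm w ν Λ (n + 1)‖) ∧
        ∃ ℓ : ℂ, IsLogPartitionFunction w ν Λ ℓ ∧
          HasSum (fun n => clusterTerm w ν Λ (n + 1)) ℓ ∧
          ‖ℓ‖ₑ ≤ absCluster w ν Λ)) := by
  have hw : ∀ x y, ‖w x y‖ₑ ≤ 1 := fun x y => by
    simpa [enorm_eq_nnnorm, ← NNReal.coe_le_one] using hw_norm x y
  have hpinned : ∀ x, absPinned w ν x ≤ μ x := absPinned_le hw_meas hw_symm hw hμ
  refine ⟨fun x => ⟨enorm_pinned_le_absPinned w ν x, hpinned x⟩, fun x hx => ?_,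
    fun Λ _ hΛ => ⟨?_, fun hμΛ => ?_⟩⟩
  · have hx : absPinned w ν x < ⊤ := (hpinned x).trans_lt hx
    exact ⟨integrable_pinnedIntegrand hw_meas hx, summable_norm_pinnedTerm hx⟩
  · exact (absCluster_le_setLIntegral_absPinned hw_meas hw_symm ν Λ).trans (lintegral_mono hpinned)
  · have hfin : absCluster w ν Λ < ⊤ := absCluster_lt_top hw_meas hw_symm hw hΛ
      (hμΛ.mono fun x hx => (hpinned x).trans_lt hx)
    exact ⟨hfin, fun n => integrableOn_clusterIntegrand hw_meas hfin (n + 1),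
      summable_norm_clusterTerm hfin, clusterSum w ν Λ 1,
      isLogPartitionFunction_clusterSum hw_meas hw_symm hfin, hasSum_clusterTerm hw_meas hfin,
      enorm_clusterSum_one_le w ν Λ⟩
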